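/- Let $Q\to\mathbf R$ be a smooth fibre bundle whose typical fibre $M$ is an $m$-dimensional manifold ($m\ge 0$) and whose total space $Q$ is Hausdorff and second countable. Let $(q^0=t,q^1,\dots,q^m)$ denote bundle coordinates on $Q$, where $t$ is the Cartesian coordinate of the base; let $(t,q^i,q^i_t)$ be the induced coordinates on the first order jet manifold $J^1Q$ of sections of $Q\to\mathbf R$, and $(t,q^i,\dot t,\dot q^i)$ those on $TQ$. Let $\lambda:J^1Q\hookrightarrow TQ$, $(t,q^i,q^i_t)\mapsto(t,q^i,\dot t=1,\dot q^i=q^i_t)$, be the canonical imbedding. Latin indices run over $1,\dots,m$ and Greek indices over $0,\dots,m$; repeated indices are summed. All objects are $C^\infty$. A connection on a bundle $Y\to X$ is a smooth section of its first order jet bundle $J^1Y\to Y$, i.e. a smooth family of linear right inverses $T_{p(y)}X\to T_yY$ of the tangent projections. A dynamic equation on $Q$ is a holonomic connection $\xi=\partial_t+q^i_t\partial_i+\xi^i(t,q^j,q^j_t)\partial^t_i$ on $J^1Q\to\mathbf R$; it is written $q^i_{tt}=\xi^i$. A dynamic connection is a connection $\gamma=dq^\mu\otimes(\partial_\mu+\gamma^i_\mu\partial^t_i)$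 on $J^1Q\to Q$; its dynamic equation is $q^i_{tt}=\gamma^i_0+q^j_t\gamma^i_j$. Let $\widetilde K$ denote a (not necessarily linear) connection on $TQ\to Q$ with $K^0_\mu=0$ in bundle coordinates, $\widetilde K=dq^\mu\otimes(\partial_\mu+K^i_\mu\,\partial/\partial\dot q^i)$. (1) For every dynamic equation $\xi$ on $Q$ there exist such a connection $\widetilde K$ on $TQ\to Q$ and a dynamic connection $\gamma$ such that, in all bundle coordinates, $\gamma^i_\mu=K^i_\mu\circ\lambda$, $\ \xi^i=\gamma^i_0+q^j_t\gamma^i_j$, and hence $\xi$ has the form $$q^i_{tt}=K^i_0\circ\lambda+q^j_t\,K^i_j\circ\lambda .\qquad(*)$$ (2) Conversely, for every connection $\widetilde K$ on $TQ\to Q$ with $K^0_\mu=0$ there is exactly one dynamic connection $\gamma$ with $\gamma^i_\mu=K^i_\mu\circ\lambda$ in all bundle coordinates, there is exactly one dynamic equation on $Q$ which has the form $(*)$ in all bundle coordinates, and the latter is the dynamic equation of $\gamma$. -/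

import Mathlib

open Set
open scoped Manifold ContDiff Topology

noncomputable section

namespace TimeDependentMechanics

/-- The coordinate space `ℝⁿ`. -/
abbrev Coord (n : ℕ) := EuclideanSpace ℝ (Fin n)

/-! ### Connections -/

section Connection

variable {EX HX EY HY X Y : Type*}
  [NormedAddCommGroup EX] [NormedSpace ℝ EX] [TopologicalSpace HX]
  [NormedAddCommGroup EY] [NormedSpace ℝ EY] [TopologicalSpace HY]
  [TopologicalSpace X] [ChartedSpace HX X] [TopologicalSpace Y] [ChartedSpace HY Y]

/-- A smooth (in general non-linear) connection on a bundle `p : Y → X`, that is a smooth section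
`y ↦ (T_{p y} X → T_y Y)` of the first order jet bundle `J¹Y → Y`: at every `y` a linear
right inverse of `T_y p` (the horizontal lift of tangent vectors), depending smoothly on `y`. -/
structure Connection (IX : ModelWithCorners ℝ EX HX) (IY : ModelWithCorners ℝ EY HY)
    [IsManifold IX 1 X] [IsManifold IY 1 Y] (p : Y → X) where
  lift : ∀ y : Y, TangentSpace IX (p y) →L[ℝ] TangentSpace IY y
  proj_lift : ∀ (y : Y) (u : TangentSpace IX (p y)), mfderiv IY IX p y (lift y u) = u
  smooth : ∀ y₀ : Y, ContMDiffAt IY 𝓘(ℝ, EX →L[ℝ] EY) ∞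
    (inTangentCoordinates IX IY p id (fun y => lift y) y₀) y₀

end Connection

/-! ### The configuration bundle `Q → ℝ` -/

/-- A smooth fibre bundle `t : Q → ℝ` over the time axis, with typical fibre the `m`-dimensional
manifold `M`. -/
structure ConfigurationBundle (m : ℕ) (Q M : Type*)
    [TopologicalSpace Q] [ChartedSpace (Coord (m + 1)) Q]
    [TopologicalSpace M] [ChartedSpace (Coord m) M] where
  time : Q → ℝ
  locallyTrivial : ∀ t₀ : ℝ, ∃ Φ : Bundle.Trivialization M time, t₀ ∈ Φ.baseSet ∧
    ContMDiffOn 𝓘(ℝ, Coord (m + 1)) (𝓘(ℝ, ℝ).prod 𝓘(ℝ, Coord m)) ∞ Φ Φ.source ∧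
    ContMDiffOn (𝓘(ℝ, ℝ).prod 𝓘(ℝ, Coord m)) 𝓘(ℝ, Coord (m + 1)) ∞
      Φ.toOpenPartialHomeomorph.symm Φ.target

/-- `(t, (y¹, …, yᵐ)) ↦ (t, y¹, …, yᵐ)`. -/
def consCoord {m : ℕ} (p : ℝ × Coord m) : Coord (m + 1) :=
  WithLp.toLp 2 (Fin.cons p.1 (fun i => p.2 i))

/-- `(x⁰, x¹, …, xᵐ) ↦ (x¹, …, xᵐ)`. -/
def tailCoord {m : ℕ} (x : Coord (m + 1)) : Coord m :=
  WithLp.toLp 2 (fun i => x i.succ)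

@[simp] theorem consCoord_zero {m : ℕ} (p : ℝ × Coord m) : consCoord p 0 = p.1 := rfl

@[simp] theorem consCoord_succ {m : ℕ} (p : ℝ × Coord m) (i : Fin m) :
    consCoord p i.succ = p.2 i := rfl

@[simp] theorem tailCoord_apply {m : ℕ} (x : Coord (m + 1)) (i : Fin m) :
    tailCoord x i = x i.succ := rfl

@[simp] theorem tailCoord_consCoord {m : ℕ} (p : ℝ × Coord m) :
    tailCoord (consCoord p) = p.2 := by
  ext i; rfl

@[simp] theorem consCoord_tailCoord {m : ℕ} (x : Coord (m + 1)) :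
    consCoord (x 0, tailCoord x) = x := by
  ext i
  refine Fin.cases ?_ (fun j => ?_) i <;> rfl

theorem contDiff_coord {n : ℕ} (i : Fin n) : ContDiff ℝ ∞ (fun x : Coord n => x i) :=
  (EuclideanSpace.proj (𝕜 := ℝ) i).contDiff

theorem contDiff_consCoord {m : ℕ} : ContDiff ℝ ∞ (consCoord (m := m)) := by
  rw [contDiff_euclidean]
  intro i
  refine Fin.cases ?_ (fun j => ?_) i
  · exact contDiff_fst
  · exact (contDiff_coord j).comp contDiff_snd

theorem contDiff_tailCoord {m : ℕ} : ContDiff ℝ ∞ (tailCoord (m := m)) := by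
  rw [contDiff_euclidean]
  intro i
  exact contDiff_coord i.succ

/-- `ℝ × ℝᵐ ≃ ℝᵐ⁺¹`. -/
def consHomeomorph (m : ℕ) : (ℝ × Coord m) ≃ₜ Coord (m + 1) where
  toFun := consCoord
  invFun x := (x 0, tailCoord x)
  left_inv p := by simp
  right_inv x := by simp
  continuous_toFun := contDiff_consCoord.continuous
  continuous_invFun := ((contDiff_coord 0).prodMk contDiff_tailCoord).continuous

namespace ConfigurationBundle

variable {m : ℕ} {Q M : Type*}
  [TopologicalSpace Q] [ChartedSpace (Coord (m + 1)) Q]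
  [TopologicalSpace M] [ChartedSpace (Coord m) M]
  (B : ConfigurationBundle m Q M)

/-- Bundle coordinates `(q⁰ = t, q¹, …, qᵐ)` on an open subset of `Q`: smooth local coordinates
whose coordinate of index `0` is the time. -/
structure Chart extends OpenPartialHomeomorph Q (Coord (m + 1)) where
  contMDiffOn_toFun : ContMDiffOn 𝓘(ℝ, Coord (m + 1)) 𝓘(ℝ, Coord (m + 1)) ∞
    toOpenPartialHomeomorph toOpenPartialHomeomorph.source
  contMDiffOn_symm : ContMDiffOn 𝓘(ℝ, Coord (m + 1)) 𝓘(ℝ, Coord (m + 1)) ∞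
    toOpenPartialHomeomorph.symm toOpenPartialHomeomorph.target
  coord_zero : ∀ q ∈ toOpenPartialHomeomorph.source, toOpenPartialHomeomorph q 0 = B.time q

/-! ### The jet manifold `J¹Q` -/

/-- A point of `J¹Q`: the first order jet at time `t(q)` of a section of `Q → ℝ` through `q`,
given by its velocity, a tangent vector `∂ₜ + qⁱₜ ∂ᵢ` at `q` which projects onto `∂ₜ`. -/
@[ext]
structure J1 where
  pt : Q
  vec : TangentSpace 𝓘(ℝ, Coord (m + 1)) pt
  dt_vec : mfderiv 𝓘(ℝ, Coord (m + 1)) 𝓘(ℝ, ℝ) B.time pt vec = (1 : ℝ)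

variable {B}

namespace Chart

variable (e : B.Chart)

theorem mdifferentiable : e.toOpenPartialHomeomorph.MDifferentiable
    𝓘(ℝ, Coord (m + 1)) 𝓘(ℝ, Coord (m + 1)) :=
  ⟨e.contMDiffOn_toFun.mdifferentiableOn (by simp), e.contMDiffOn_symm.mdifferentiableOn (by simp)⟩

/-- The derivative `v = vᵘ ∂ᵤ ↦ (v⁰, …, vᵐ)` of the coordinate map at `q`. -/
def D (q : Q) : TangentSpace 𝓘(ℝ, Coord (m + 1)) q →L[ℝ] Coord (m + 1) :=
  mfderiv 𝓘(ℝ, Coord (m + 1)) 𝓘(ℝ, Coord (m + 1)) e.toOpenPartialHomeomorph q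

/-- The tangent vector `aᵘ ∂ᵤ` at the point with coordinates `x`. -/
def Dsymm (x : Coord (m + 1)) :
    Coord (m + 1) →L[ℝ] TangentSpace 𝓘(ℝ, Coord (m + 1)) (e.symm x) :=
  mfderiv 𝓘(ℝ, Coord (m + 1)) 𝓘(ℝ, Coord (m + 1)) e.toOpenPartialHomeomorph.symm x

theorem D_Dsymm {x : Coord (m + 1)} (hx : x ∈ e.target) (a : Coord (m + 1)) :
    e.D (e.symm x) (e.Dsymm x a) = a :=
  DFunLike.congr_fun (e.mdifferentiable.comp_symm_deriv hx) a

theorem D_zero {q : Q} (hq : q ∈ e.source) (v : TangentSpace 𝓘(ℝ, Coord (m + 1)) q) :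
    e.D q v 0 = mfderiv 𝓘(ℝ, Coord (m + 1)) 𝓘(ℝ, ℝ) B.time q v := by
  have h1 : B.time =ᶠ[𝓝 q] (fun x : Coord (m + 1) => x 0) ∘ e.toOpenPartialHomeomorph :=
    Filter.eventually_of_mem (e.open_source.mem_nhds hq) (fun y hy => (e.coord_zero y hy).symm)
  have h2 : MDifferentiableAt 𝓘(ℝ, Coord (m + 1)) 𝓘(ℝ, ℝ) (fun x : Coord (m + 1) => x 0)
      (e.toOpenPartialHomeomorph q) :=
    (contDiff_coord 0).contMDiff.mdifferentiable (by simp) _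
  rw [h1.mfderiv_eq, mfderiv_comp q h2 (e.mdifferentiable.mdifferentiableAt hq), mfderiv_eq_fderiv,
    show (fun x : Coord (m + 1) => x 0) = EuclideanSpace.proj (𝕜 := ℝ) (0 : Fin (m + 1)) from rfl,
    ContinuousLinearMap.fderiv]
  rfl

theorem dt_Dsymm {x : Coord (m + 1)} (hx : x ∈ e.target) (y : Coord m) :
    mfderiv 𝓘(ℝ, Coord (m + 1)) 𝓘(ℝ, ℝ) B.time (e.symm x) (e.Dsymm x (consCoord (1, y)))
      = (1 : ℝ) := by
  rw [← e.D_zero (e.map_target hx), e.D_Dsymm hx]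
  rfl

variable [IsManifold 𝓘(ℝ, Coord m) ∞ M]

variable (B) in
/-- Every point of `Q` lies in the domain of some bundle coordinates. -/
theorem _root_.TimeDependentMechanics.ConfigurationBundle.exists_chart (q : Q) : ∃ e : B.Chart, q ∈ e.source := by
  obtain ⟨Φ, hb, h1, h2⟩ := B.locallyTrivial (B.time q)
  have hq : q ∈ Φ.source := Φ.mem_source.2 hb
  let c : OpenPartialHomeomorph M (Coord m) := chartAt (Coord m) (Φ q).2
  have hc1 : ContMDiffOn 𝓘(ℝ, Coord m) 𝓘(ℝ, Coord m) ∞ c c.source := contMDiffOn_chart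
  have hc2 : ContMDiffOn 𝓘(ℝ, Coord m) 𝓘(ℝ, Coord m) ∞ c.symm c.target := contMDiffOn_chart_symm
  let e : OpenPartialHomeomorph Q (Coord (m + 1)) :=
    (Φ.toOpenPartialHomeomorph.trans ((OpenPartialHomeomorph.refl ℝ).prod c)).trans
      (consHomeomorph m).toOpenPartialHomeomorph
  have hs : ∀ x ∈ e.source, x ∈ Φ.source ∧ (Φ x).2 ∈ c.source := by
    intro x hx
    simpa [e] using hx
  have ht : ∀ x ∈ e.target, tailCoord x ∈ c.target ∧ (x 0, c.symm (tailCoord x)) ∈ Φ.target := by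
    intro x hx
    simpa [e, consHomeomorph, and_comm] using hx
  refine ⟨⟨e, ?_, ?_, ?_⟩, ?_⟩
  · intro x hx
    have A := (h1.mono (fun y hy => (hs y hy).1)) x hx
    have B1 := A.fst
    have B2 := (hc1 (Φ x).2 (hs x hx).2).comp x A.snd (fun y hy => (hs y hy).2)
    exact contDiff_consCoord.contMDiff.contMDiffAt.comp_contMDiffWithinAt x
      (B1.prodMk_space B2)
  · intro x hx
    have A := (hc2 (tailCoord x) (ht x hx).1).comp x
      (contDiff_tailCoord.contMDiff.contMDiffAt.contMDiffWithinAt) (fun y hy => (ht y hy).1)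
    have A' := (contDiff_coord (n := m + 1) 0).contMDiff.contMDiffAt.contMDiffWithinAt
      (x := x) (s := e.target)
    exact ContMDiffWithinAt.comp (f := fun x => (x 0, c.symm (tailCoord x))) x
      (h2 _ (ht x hx).2) (A'.prodMk A) (fun y hy => (ht y hy).2)
  · intro x hx
    have := Φ.proj_toFun x (hs x hx).1
    exact this
  · have : (Φ q).2 ∈ c.source := mem_chart_source _ _
    simpa [e] using And.intro hq this

open Classical in
/-- The coordinates `(q⁰ = t, qⁱ, qⁱₜ)` on `J¹Q` induced by bundle coordinates on `Q`. -/
def jet : PartialEquiv B.J1 (Coord (m + 1) × Coord m) where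
  toFun v := (e.toOpenPartialHomeomorph v.pt, tailCoord (e.D v.pt v.vec))
  invFun p :=
    if h : p.1 ∈ e.target then ⟨e.symm p.1, e.Dsymm p.1 (consCoord (1, p.2)), e.dt_Dsymm h p.2⟩
    else Classical.choice (by
      obtain ⟨e', h'⟩ := B.exists_chart (e.symm p.1)
      exact ⟨⟨_, _, e'.dt_Dsymm (e'.map_source h') 0⟩⟩)
  source := {v | v.pt ∈ e.source}
  target := e.target ×ˢ univ
  map_source' v hv := ⟨e.map_source hv, mem_univ _⟩
  map_target' p hp := by
    have h : p.1 ∈ e.target := hp.1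
    simp only [h, dite_true]
    exact e.map_target h
  left_inv' v hv := by
    have hv' : v.pt ∈ e.source := hv
    have h : e.toOpenPartialHomeomorph v.pt ∈ e.target := e.map_source hv'
    have h0 : consCoord (1, tailCoord (e.D v.pt v.vec)) = e.D v.pt v.vec := by
      conv_rhs => rw [← consCoord_tailCoord (e.D v.pt v.vec)]
      rw [e.D_zero hv', v.dt_vec]
    simp only [h, dite_true, h0]
    have h1 : e.Dsymm (e.toOpenPartialHomeomorph v.pt) (e.D v.pt v.vec) = v.vec :=
      DFunLike.congr_fun (e.mdifferentiable.symm_comp_deriv hv') v.vec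
    ext1
    · exact e.left_inv hv'
    · exact h1
  right_inv' p hp := by
    have h : p.1 ∈ e.target := hp.1
    rw [dif_pos h]
    ext1
    · exact e.right_inv h
    · simp only [e.D_Dsymm h, tailCoord_consCoord]

theorem jet_symm_eq {p : Coord (m + 1) × Coord m} (h : p.1 ∈ e.target) :
    e.jet.symm p = ⟨e.symm p.1, e.Dsymm p.1 (consCoord (1, p.2)), e.dt_Dsymm h p.2⟩ :=
  dif_pos h

theorem jet_symm_pt {p : Coord (m + 1) × Coord m} (h : p.1 ∈ e.target) :
    (e.jet.symm p).pt = e.symm p.1 := by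
  rw [e.jet_symm_eq h]

theorem jet_symm_source (e' : B.Chart) :
    (e.jet.symm.trans e'.jet).source =
      (e.toOpenPartialHomeomorph.symm.trans e'.toOpenPartialHomeomorph).source ×ˢ univ := by
  ext p
  have : p ∈ (e.jet.symm.trans e'.jet).source ↔
      p.1 ∈ e.target ∧ (e.jet.symm p).pt ∈ e'.source := by
    simp [jet]
  rw [this]
  simp only [OpenPartialHomeomorph.trans_source, mem_prod, mem_univ, and_true]
  refine and_congr_right fun h => ?_
  rw [e.jet_symm_pt h]
  rfl

theorem jet_trans (e' : B.Chart) : ContDiffOn ℝ ∞ (e.jet.symm.trans e'.jet)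
    (e.jet.symm.trans e'.jet).source := by
  set φ := e.toOpenPartialHomeomorph.symm.trans e'.toOpenPartialHomeomorph with hφ
  have h1 : ContDiffOn ℝ ∞ φ φ.source := by
    rw [← contMDiffOn_iff_contDiffOn]
    exact e'.contMDiffOn_toFun.comp (e.contMDiffOn_symm.mono (fun x hx => by
      rw [hφ, OpenPartialHomeomorph.trans_source] at hx; exact hx.1)) (fun x hx => by
      rw [hφ, OpenPartialHomeomorph.trans_source] at hx; exact hx.2)
  have h2 : ContDiffOn ℝ ∞ (fun p : Coord (m + 1) × Coord m =>
      (φ p.1, tailCoord (fderiv ℝ φ p.1 (consCoord (1, p.2))))) (φ.source ×ˢ univ) := by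
    have h3 : ContDiffOn ℝ ∞ (fderiv ℝ φ) φ.source :=
      h1.fderiv_of_isOpen φ.open_source (by simp)
    have h4 : ContDiffOn ℝ ∞ (fun p : Coord (m + 1) × Coord m => fderiv ℝ φ p.1)
        (φ.source ×ˢ univ) := h3.comp contDiff_fst.contDiffOn (fun p hp => hp.1)
    exact (h1.comp contDiff_fst.contDiffOn (fun p hp => hp.1)).prodMk
      (contDiff_tailCoord.comp_contDiffOn (h4.clm_apply
        (contDiff_consCoord.comp (contDiff_const.prodMk contDiff_snd)).contDiffOn))
  rw [jet_symm_source]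
  refine h2.congr fun p hp => ?_
  have hx : p.1 ∈ e.target ∧ e.symm p.1 ∈ e'.source := by
    have := hp.1
    rw [OpenPartialHomeomorph.trans_source] at this
    exact this
  have h5 : fderiv ℝ φ p.1 (consCoord (1, p.2)) =
      e'.D (e.symm p.1) (e.Dsymm p.1 (consCoord (1, p.2))) := by
    rw [← mfderiv_eq_fderiv]
    have := mfderiv_comp p.1 (e'.mdifferentiable.mdifferentiableAt hx.2)
      (e.mdifferentiable.mdifferentiableAt_symm hx.1)
    exact DFunLike.congr_fun this _
  change (e'.toOpenPartialHomeomorph (e.jet.symm p).pt,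
    tailCoord (e'.D (e.jet.symm p).pt (e.jet.symm p).vec)) = _
  rw [e.jet_symm_eq hx.1, h5]
  rfl

end Chart

variable (B) [IsManifold 𝓘(ℝ, Coord m) ∞ M]

/-- The coordinates `(t, qⁱ, qⁱₜ)` make up an atlas of `J¹Q`. -/
def jetAtlas : ChartedSpaceCore (Coord (m + 1) × Coord m) B.J1 where
  atlas := range (fun e : B.Chart => e.jet)
  chartAt v := (B.exists_chart v.pt).choose.jet
  mem_chart_source v := (B.exists_chart v.pt).choose_spec
  chart_mem_atlas v := mem_range_self _
  open_source := by
    rintro _ _ ⟨e, rfl⟩ ⟨e', rfl⟩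
    dsimp only
    rw [Chart.jet_symm_source]
    exact (OpenPartialHomeomorph.open_source _).prod isOpen_univ
  continuousOn_toFun := by
    rintro _ _ ⟨e, rfl⟩ ⟨e', rfl⟩
    exact (e.jet_trans e').continuousOn

instance : TopologicalSpace B.J1 := B.jetAtlas.toTopologicalSpace

instance : ChartedSpace (Coord (m + 1) × Coord m) B.J1 := B.jetAtlas.toChartedSpace

instance : IsManifold 𝓘(ℝ, Coord (m + 1) × Coord m) ∞ B.J1 := by
  refine isManifold_of_contDiffOn _ _ _ ?_
  intro f f' hf hf'
  obtain ⟨_, ⟨e, rfl⟩, rfl⟩ : ∃ (g : _) (hg : g ∈ B.jetAtlas.atlas),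
      f = B.jetAtlas.openPartialHomeomorph g hg := by
    simpa [atlas, ChartedSpace.atlas, ChartedSpaceCore.toChartedSpace] using hf
  obtain ⟨_, ⟨e', rfl⟩, rfl⟩ : ∃ (g : _) (hg : g ∈ B.jetAtlas.atlas),
      f' = B.jetAtlas.openPartialHomeomorph g hg := by
    simpa [atlas, ChartedSpace.atlas, ChartedSpaceCore.toChartedSpace] using hf'
  refine (e.jet_trans e').mono ?_
  intro x hx
  simp only [mfld_simps] at hx
  rw [PartialEquiv.trans_source]
  exact hx

variable [IsManifold 𝓘(ℝ, Coord (m + 1)) ∞ Q]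

/-! ### Dynamic equations, dynamic connections, connections on `TQ → Q` -/

/-- The canonical imbedding `λ : J¹Q → TQ`. -/
def imbed (v : B.J1) : TangentBundle 𝓘(ℝ, Coord (m + 1)) Q := ⟨v.pt, v.vec⟩

/-- A dynamic equation on `Q → ℝ`: a connection `ξ` on `J¹Q → ℝ` which is holonomic, that is, takes
its values in `J²Q`: the horizontal lift `ξ = ξ(∂ₜ)`, which is a vector field on `J¹Q`, projects at
every `v ∈ J¹Q` onto the velocity `λ(v)`; so `ξ = ∂ₜ + qⁱₜ ∂ᵢ + ξⁱ ∂ᵢᵗ`. -/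
structure DynamicEquation extends
    Connection 𝓘(ℝ, ℝ) 𝓘(ℝ, Coord (m + 1) × Coord m) (fun v : B.J1 => B.time v.pt) where
  holonomic : ∀ v : B.J1, mfderiv 𝓘(ℝ, Coord (m + 1) × Coord m) 𝓘(ℝ, Coord (m + 1))
    (J1.pt : B.J1 → Q) v (lift v (1 : ℝ)) = v.vec

/-- A dynamic connection: a connection `γ` on the affine jet bundle `J¹Q → Q`. -/
abbrev DynamicConnection :=
  Connection 𝓘(ℝ, Coord (m + 1)) 𝓘(ℝ, Coord (m + 1) × Coord m) (J1.pt : B.J1 → Q)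

/-- A (non-linear) connection `K` on the tangent bundle `TQ → Q`. -/
abbrev TangentConnection (_B : ConfigurationBundle m Q M) :=
  Connection 𝓘(ℝ, Coord (m + 1)) 𝓘(ℝ, Coord (m + 1)).tangent
    (Bundle.TotalSpace.proj : TangentBundle 𝓘(ℝ, Coord (m + 1)) Q → Q)

variable {B}

/-- The coordinate vector `∂_μ` at `q` (for `q` in the domain of the coordinates). -/
def Chart.partialVec (e : B.Chart) (μ : Fin (m + 1)) (q : Q) :
    TangentSpace 𝓘(ℝ, Coord (m + 1)) q :=
  e.Dsymm (e.toOpenPartialHomeomorph q) (EuclideanSpace.single μ (1 : ℝ))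

/-- The fibre coordinate `q̇^ν` on `TQ`. -/
def Chart.dot (e : B.Chart) (ν : Fin (m + 1)) (w : TangentBundle 𝓘(ℝ, Coord (m + 1)) Q) : ℝ :=
  e.D w.proj w.snd ν

/-- The fibre coordinate `qⁱₜ` on `J¹Q`. -/
def Chart.vel (e : B.Chart) (i : Fin m) (v : B.J1) : ℝ :=
  e.D v.pt v.vec i.succ

/-- The component `ξⁱ` of a dynamic equation. -/
def DynamicEquation.comp (ξ : B.DynamicEquation) (e : B.Chart) (i : Fin m) (v : B.J1) : ℝ :=
  mfderiv 𝓘(ℝ, Coord (m + 1) × Coord m) 𝓘(ℝ, ℝ) (e.vel i) v (ξ.lift v (1 : ℝ))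

/-- The component `γⁱ_μ` of a dynamic connection. -/
def DynamicConnection.comp (γ : B.DynamicConnection) (e : B.Chart) (i : Fin m) (μ : Fin (m + 1))
    (v : B.J1) : ℝ :=
  mfderiv 𝓘(ℝ, Coord (m + 1) × Coord m) 𝓘(ℝ, ℝ) (e.vel i) v (γ.lift v (e.partialVec μ v.pt))

/-- The component `K^ν_μ` of a connection on `TQ → Q`. -/
def TangentConnection.comp (K : B.TangentConnection) (e : B.Chart) (ν μ : Fin (m + 1))
    (w : TangentBundle 𝓘(ℝ, Coord (m + 1)) Q) : ℝ :=
  mfderiv 𝓘(ℝ, Coord (m + 1)).tangent 𝓘(ℝ, ℝ) (e.dot ν) w (K.lift w (e.partialVec μ w.proj))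

/-- `K⁰_μ = 0` in all bundle coordinates: `K = dq^μ ⊗ (∂_μ + Kⁱ_μ ∂̇ᵢ)`. -/
def TangentConnection.TimeComponentsVanish (K : B.TangentConnection) : Prop :=
  ∀ (e : B.Chart) (w : TangentBundle 𝓘(ℝ, Coord (m + 1)) Q), w.proj ∈ e.source →
    ∀ μ : Fin (m + 1), K.comp e 0 μ w = 0

/-- The dynamic equation `qⁱₜₜ = γⁱ₀ + qʲₜ γⁱⱼ` of a dynamic connection is `ξ`. -/
def DynamicConnection.Yields (γ : B.DynamicConnection) (ξ : B.DynamicEquation) : Prop :=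
  ∀ (e : B.Chart) (v : B.J1), v.pt ∈ e.source → ∀ i : Fin m,
    ξ.comp e i v = γ.comp e i 0 v + ∑ j : Fin m, e.vel j v * γ.comp e i j.succ v

/-- `γⁱ_μ = Kⁱ_μ ∘ λ` in all bundle coordinates. -/
def TangentConnection.RestrictsTo (K : B.TangentConnection) (γ : B.DynamicConnection) : Prop :=
  ∀ (e : B.Chart) (v : B.J1), v.pt ∈ e.source → ∀ (i : Fin m) (μ : Fin (m + 1)),
    γ.comp e i μ v = K.comp e i.succ μ (B.imbed v)

/-- The dynamic equation `ξ` has the form `qⁱₜₜ = Kⁱ₀ ∘ λ + qʲₜ Kⁱⱼ ∘ λ` in all bundle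
coordinates. -/
def DynamicEquation.HasForm (ξ : B.DynamicEquation) (K : B.TangentConnection) : Prop :=
  ∀ (e : B.Chart) (v : B.J1), v.pt ∈ e.source → ∀ i : Fin m,
    ξ.comp e i v = K.comp e i.succ 0 (B.imbed v)
      + ∑ j : Fin m, e.vel j v * K.comp e i.succ j.succ (B.imbed v)

end ConfigurationBundle

end TimeDependentMechanics
end

open Set
open scoped Manifold ContDiff Topology

noncomputable section

set_option linter.unusedSectionVars false

namespace TimeDependentMechanics

/-! ### Families of linear maps between tangent spaces -/

section InTangentCoordinates

variable {E H E' H' E'' H'' F G M M' M'' N : Type*}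
  [NormedAddCommGroup E] [NormedSpace ℝ E] [TopologicalSpace H] {I : ModelWithCorners ℝ E H}
  [NormedAddCommGroup E'] [NormedSpace ℝ E'] [TopologicalSpace H'] {I' : ModelWithCorners ℝ E' H'}
  [NormedAddCommGroup E''] [NormedSpace ℝ E''] [TopologicalSpace H'']
  {I'' : ModelWithCorners ℝ E'' H''}
  [NormedAddCommGroup F] [NormedSpace ℝ F] [TopologicalSpace G] {J : ModelWithCorners ℝ F G}
  [TopologicalSpace M] [ChartedSpace H M] [TopologicalSpace M'] [ChartedSpace H' M']
  [TopologicalSpace M''] [ChartedSpace H'' M'']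
  [IsManifold I 1 M] [IsManifold I' 1 M'] [IsManifold I'' 1 M'']

/-! All coordinate formulas are reduced to chart-free statements about tangent maps. The coordinate
`ṫ` is the global function `dt` on `TQ`, so the vanishing of `K⁰_μ` means that horizontal vectors
annihilate `dṫ`.

From `K` to `γ`: the open set `{ṫ ≠ 0}` retracts onto `J¹Q` by `q̇ ↦ q̇ / ṫ` (`toJet`). Applying the
tangent map of this retraction to the horizontal lifts of `K` along `λ` gives a dynamic connection;
on vectors with `dṫ = 0` at `ṫ = 1` the `∂/∂q̇ⁱ`-components survive unchanged (`mfderiv_vel_toJet`),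
so its components are `Kⁱ_μ ∘ λ`. Lifting the velocity `∂ₜ + qʲₜ ∂ⱼ` by `γ` gives the dynamic
equation. Uniqueness holds because a tangent vector of `J¹Q` is determined by its projection to `Q`
and its `dqⁱₜ`-components (`jet_tangent_ext`).

From `ξ` to `K`: in one chart take `Kⁱ₀(q, q̇) = ξⁱ(q, q̇)`, without `ṫ`-dependence, and `Kⁱⱼ = 0`.
The horizontal lift of the velocity `v` at `λ(v)` is then `Tλ(ξ(∂ₜ))` (`localLift_vec`). This
equation is chart-free, affine in the connection and implies the form `(*)` in every chart
(`hasForm_of_lift_vec`). It therefore survives gluing by a partition of unity on `Q`, as does `dṫ =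
0`. -/

theorem inTangentCoordinates_comp {f : N → M} {g : N → M'} {h : N → M''} {ϕ : N → E →L[ℝ] E'}
    {ψ : N → E' →L[ℝ] E''} {x₀ x : N} (hx : g x ∈ (chartAt H' (g x₀)).source) :
    inTangentCoordinates I I'' f h (fun x => ψ x ∘L ϕ x) x₀ x =
      inTangentCoordinates I' I'' g h ψ x₀ x ∘L inTangentCoordinates I I' f g ϕ x₀ x := by
  have hb : g x ∈ (trivializationAt E' (TangentSpace I' : M' → Type _) (g x₀)).baseSet := hx
  ext u
  exact (congrArg (fun z => (trivializationAt E'' (TangentSpace I'' : M'' → Type _)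
    (h x₀)).continuousLinearMapAt ℝ (h x) (ψ x z))
    (Bundle.Trivialization.symmL_continuousLinearMapAt _ hb _)).symm

theorem inTangentCoordinates_sum_smul {ι : Type*} {f : N → M} {g : N → M'} (s : Finset ι)
    (c : ι → N → ℝ) (ϕ : ι → N → E →L[ℝ] E') (x₀ x : N) :
    inTangentCoordinates I I' f g (fun x => ∑ i ∈ s, c i x • ϕ i x) x₀ x =
      ∑ i ∈ s, c i x • inTangentCoordinates I I' f g (ϕ i) x₀ x := by
  ext u
  simp only [sum_apply, smul_apply]
  let A : E' →L[ℝ] E' := (trivializationAt E' (TangentSpace I' : M' → Type _)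
    (g x₀)).continuousLinearMapAt ℝ (g x)
  let C : E →L[ℝ] E := (trivializationAt E (TangentSpace I : M → Type _) (f x₀)).symmL ℝ (f x)
  change A ((∑ i ∈ s, c i x • ϕ i x) (C u)) = ∑ i ∈ s, c i x • A (ϕ i x (C u))
  simp only [sum_apply, smul_apply, map_sum, map_smul]

variable [TopologicalSpace N] [ChartedSpace G N]

/-- The middle trivialization at `g x₀` cancels only where `g x` stays in its chart; continuity of
`g` provides this near `x₀`. -/
theorem contMDiffAt_inTangentCoordinates_comp {f : N → M} {g : N → M'} {h : N → M''}
    {ϕ : N → E →L[ℝ] E'} {ψ : N → E' →L[ℝ] E''} {x₀ : N}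
    (hψ : ContMDiffAt J 𝓘(ℝ, E' →L[ℝ] E'') ∞ (inTangentCoordinates I' I'' g h ψ x₀) x₀)
    (hϕ : ContMDiffAt J 𝓘(ℝ, E →L[ℝ] E') ∞ (inTangentCoordinates I I' f g ϕ x₀) x₀)
    (hg : ContinuousAt g x₀) :
    ContMDiffAt J 𝓘(ℝ, E →L[ℝ] E'') ∞
      (inTangentCoordinates I I'' f h (fun x => ψ x ∘L ϕ x) x₀) x₀ := by
  refine (hψ.clm_comp hϕ).congr_of_eventuallyEq ?_
  filter_upwards [hg.preimage_mem_nhds ((chartAt H' (g x₀)).open_source.mem_nhds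
    (mem_chart_source H' (g x₀)))] with x hx
  exact inTangentCoordinates_comp hx

/-- All tangent spaces of a manifold are the same model space, so the family can be typed
independently of its base maps. Base maps that agree only propositionally, such as `toJet ∘ imbed`
and `id`, can then be exchanged. -/
theorem contMDiffAt_inTangentCoordinates_congr {f f' : N → M} {g g' : N → M'}
    {ϕ ϕ' : N → E →L[ℝ] E'} {x₀ : N}
    (h : ContMDiffAt J 𝓘(ℝ, E →L[ℝ] E') ∞ (inTangentCoordinates I I' f g ϕ x₀) x₀)
    (hf : f' =ᶠ[𝓝 x₀] f) (hg : g' =ᶠ[𝓝 x₀] g) (hϕ : ϕ' =ᶠ[𝓝 x₀] ϕ) :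
    ContMDiffAt J 𝓘(ℝ, E →L[ℝ] E') ∞ (inTangentCoordinates I I' f' g' ϕ' x₀) x₀ := by
  refine h.congr_of_eventuallyEq ?_
  filter_upwards [hf, hg, hϕ] with x h1 h2 h3
  let T : M → M → M' → M' → (E →L[ℝ] E') → E →L[ℝ] E' := fun a b c d ψ =>
    ContinuousLinearMap.inCoordinates E (TangentSpace I) E' (TangentSpace I') a b c d ψ
  change T (f' x₀) (f' x) (g' x₀) (g' x) (ϕ' x) = T (f x₀) (f x) (g x₀) (g x) (ϕ x)
  rw [h1, h2, h3, hf.eq_of_nhds, hg.eq_of_nhds]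

theorem contMDiffAt_inTangentCoordinates_vectorSpace {f : N → E} {g : N → E'}
    {ϕ : N → E →L[ℝ] E'} {x₀ : N} :
    ContMDiffAt J 𝓘(ℝ, E →L[ℝ] E') ∞ (inTangentCoordinates 𝓘(ℝ, E) 𝓘(ℝ, E') f g ϕ x₀) x₀ ↔
      ContMDiffAt J 𝓘(ℝ, E →L[ℝ] E') ∞ ϕ x₀ := by
  rw [inTangentCoordinates_model_space]

variable [IsManifold J 1 N]

/-- The derivatives of a smooth map at the values of another one depend smoothly on the point. -/
theorem contMDiffAt_inTangentCoordinates_mfderiv {g : N → M'} {S : M' → M''} {x₀ : N}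
    (hS : ContMDiffAt I' I'' ∞ S (g x₀)) (hg : ContMDiffAt J I' ∞ g x₀) :
    ContMDiffAt J 𝓘(ℝ, E' →L[ℝ] E'') ∞
      (inTangentCoordinates I' I'' g (fun x => S (g x)) (fun x => mfderiv I' I'' S (g x)) x₀) x₀ :=
  ContMDiffAt.mfderiv (fun _ => S) g
    (ContMDiffAt.comp (x₀, g x₀) (g := S) (f := Prod.snd) hS contMDiffAt_snd) hg (by simp)

theorem contMDiffAt_inTangentCoordinates_mfderiv_comp {f : N → M} {g : N → M'}
    {ϕ : N → E →L[ℝ] E'} {S : M' → M''} {x₀ : N} (hS : ContMDiffAt I' I'' ∞ S (g x₀))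
    (hg : ContMDiffAt J I' ∞ g x₀)
    (hϕ : ContMDiffAt J 𝓘(ℝ, E →L[ℝ] E') ∞ (inTangentCoordinates I I' f g ϕ x₀) x₀) :
    ContMDiffAt J 𝓘(ℝ, E →L[ℝ] E'') ∞ (inTangentCoordinates I I'' f (fun x => S (g x))
      (fun x => (mfderiv I' I'' S (g x) : E' →L[ℝ] E'') ∘L ϕ x) x₀) x₀ :=
  contMDiffAt_inTangentCoordinates_comp (contMDiffAt_inTangentCoordinates_mfderiv hS hg) hϕ
    hg.continuousAt

end InTangentCoordinates

/-! ### Smooth maps into and between tangent bundles. -/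

section TangentBundle

variable {E F : Type*} [NormedAddCommGroup E] [NormedSpace ℝ E]
  [NormedAddCommGroup F] [NormedSpace ℝ F]
  {H M : Type*} [TopologicalSpace H] {I : ModelWithCorners ℝ F H}
  [TopologicalSpace M] [ChartedSpace H M] [IsManifold I ∞ M]

theorem contMDiff_tangentBundle_mk :
    ContMDiff 𝓘(ℝ, E × E) 𝓘(ℝ, E).tangent ∞
      (fun p : E × E => (⟨p.1, p.2⟩ : TangentBundle 𝓘(ℝ, E) E)) := by
  intro p
  rw [Bundle.contMDiffAt_totalSpace]
  refine ⟨contDiff_fst.contMDiff.contMDiffAt, ?_⟩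
  simp only [trivializationAt_model_space_apply]
  exact contDiff_snd.contMDiff.contMDiffAt

theorem contMDiffAt_tangentMap {E' H' M' : Type*} [NormedAddCommGroup E'] [NormedSpace ℝ E']
    [TopologicalSpace H'] {I' : ModelWithCorners ℝ E' H'} [TopologicalSpace M']
    [ChartedSpace H' M'] [IsManifold I' ∞ M'] {f : M → M'} {s : Set M}
    (hf : ContMDiffOn I I' ∞ f s) (hs : IsOpen s) {w : TangentBundle I M} (hw : w.proj ∈ s) :
    ContMDiffAt I.tangent I'.tangent ∞ (_root_.tangentMap I I' f) w := by
  have h := hf.contMDiffOn_tangentMapWithin (m := ∞) (by simp) hs.uniqueMDiffOn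
  have ho : IsOpen (Bundle.TotalSpace.proj ⁻¹' s : Set (TangentBundle I M)) :=
    hs.preimage (FiberBundle.continuous_proj _ _)
  refine (h.contMDiffAt (ho.mem_nhds hw)).congr_of_eventuallyEq ?_
  filter_upwards [ho.mem_nhds hw] with y hy
  simp only [_root_.tangentMap, tangentMapWithin, mfderivWithin_of_isOpen hs hy]

end TangentBundle

namespace ConfigurationBundle

variable {m : ℕ} {Q M : Type*}
  [TopologicalSpace Q] [ChartedSpace (Coord (m + 1)) Q]
  [TopologicalSpace M] [ChartedSpace (Coord m) M]
  {B : ConfigurationBundle m Q M}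
  [IsManifold 𝓘(ℝ, Coord m) ∞ M]

/-! ### Smoothness of the coordinates on `J¹Q` and `TQ` -/

namespace Chart

variable (e : B.Chart)

/-- The coordinates `(t, qⁱ, qⁱₜ)` as a chart of the manifold `J¹Q`. -/
def jetChart : OpenPartialHomeomorph B.J1 (Coord (m + 1) × Coord m) :=
  B.jetAtlas.openPartialHomeomorph e.jet (mem_range_self e)

theorem jetChart_mem_atlas : e.jetChart ∈ atlas (Coord (m + 1) × Coord m) B.J1 := by
  simp only [atlas, ChartedSpace.atlas, mem_iUnion, mem_singleton_iff]
  exact ⟨e.jet, mem_range_self e, rfl⟩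

theorem isOpen_jet_source : IsOpen {v : B.J1 | v.pt ∈ e.source} :=
  e.jetChart.open_source

theorem contMDiffOn_jet : ContMDiffOn 𝓘(ℝ, Coord (m + 1) × Coord m)
    𝓘(ℝ, Coord (m + 1) × Coord m) ∞ e.jet {v : B.J1 | v.pt ∈ e.source} :=
  contMDiffOn_of_mem_maximalAtlas (IsManifold.subset_maximalAtlas e.jetChart_mem_atlas)

theorem contMDiffAt_jet {v : B.J1} (hv : v.pt ∈ e.source) :
    ContMDiffAt 𝓘(ℝ, Coord (m + 1) × Coord m) 𝓘(ℝ, Coord (m + 1) × Coord m) ∞ e.jet v :=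
  e.contMDiffOn_jet.contMDiffAt (e.isOpen_jet_source.mem_nhds hv)

theorem contMDiffAt_jet_symm {p : Coord (m + 1) × Coord m} (hp : p.1 ∈ e.target) :
    ContMDiffAt 𝓘(ℝ, Coord (m + 1) × Coord m) 𝓘(ℝ, Coord (m + 1) × Coord m) ∞ e.jet.symm p :=
  (contMDiffOn_symm_of_mem_maximalAtlas
    (IsManifold.subset_maximalAtlas e.jetChart_mem_atlas)).contMDiffAt
    (e.jetChart.open_target.mem_nhds (show p ∈ e.target ×ˢ univ from ⟨hp, mem_univ _⟩))

theorem contMDiffAt {q : Q} (hq : q ∈ e.source) :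
    ContMDiffAt 𝓘(ℝ, Coord (m + 1)) 𝓘(ℝ, Coord (m + 1)) ∞ e.toOpenPartialHomeomorph q :=
  e.contMDiffOn_toFun.contMDiffAt (e.open_source.mem_nhds hq)

theorem contMDiffAt_symm {x : Coord (m + 1)} (hx : x ∈ e.target) :
    ContMDiffAt 𝓘(ℝ, Coord (m + 1)) 𝓘(ℝ, Coord (m + 1)) ∞ e.toOpenPartialHomeomorph.symm x :=
  e.contMDiffOn_symm.contMDiffAt (e.open_target.mem_nhds hx)

/-- The vector `(q¹ₜ, …, qᵐₜ)` of fibre coordinates on `J¹Q`. -/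
def velVec (v : B.J1) : Coord m := tailCoord (e.D v.pt v.vec)

theorem contMDiffAt_velVec {v : B.J1} (hv : v.pt ∈ e.source) :
    ContMDiffAt 𝓘(ℝ, Coord (m + 1) × Coord m) 𝓘(ℝ, Coord m) ∞ e.velVec v :=
  contDiff_snd.contMDiff.contMDiffAt.comp v (e.contMDiffAt_jet hv)

theorem D_vec {v : B.J1} (hv : v.pt ∈ e.source) :
    e.D v.pt v.vec = consCoord (1, e.velVec v) := by
  conv_lhs => rw [← consCoord_tailCoord (e.D v.pt v.vec)]
  rw [e.D_zero hv, v.dt_vec]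
  rfl

theorem Dsymm_D {q : Q} (hq : q ∈ e.source) (u : TangentSpace 𝓘(ℝ, Coord (m + 1)) q) :
    e.Dsymm (e.toOpenPartialHomeomorph q) (e.D q u) = u :=
  DFunLike.congr_fun (e.mdifferentiable.symm_comp_deriv hq) u

end Chart

theorem contMDiff_time : ContMDiff 𝓘(ℝ, Coord (m + 1)) 𝓘(ℝ, ℝ) ∞ B.time := by
  intro q
  obtain ⟨e, hq⟩ := B.exists_chart q
  exact ((contDiff_coord 0).contMDiff.contMDiffAt.comp q (e.contMDiffAt hq)).congr_of_eventuallyEq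
    (Filter.eventually_of_mem (e.open_source.mem_nhds hq) (fun y hy => (e.coord_zero y hy).symm))

theorem contMDiff_pt : ContMDiff 𝓘(ℝ, Coord (m + 1) × Coord m) 𝓘(ℝ, Coord (m + 1)) ∞
    (J1.pt : B.J1 → Q) := by
  intro v
  obtain ⟨e, hv⟩ := B.exists_chart v.pt
  have h1 : ContMDiffAt 𝓘(ℝ, Coord (m + 1) × Coord m) 𝓘(ℝ, Coord (m + 1)) ∞
      (fun w : B.J1 => (e.jet w).1) v :=
    contDiff_fst.contMDiff.contMDiffAt.comp v (e.contMDiffAt_jet hv)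
  refine (ContMDiffAt.comp v (e.contMDiffAt_symm (e.map_source hv)) h1).congr_of_eventuallyEq ?_
  filter_upwards [e.isOpen_jet_source.mem_nhds hv] with w hw
  exact (e.left_inv hw).symm

variable [IsManifold 𝓘(ℝ, Coord (m + 1)) ∞ Q]

namespace Chart

variable (e : B.Chart)

/-- The coordinates `(q^μ, q̇^μ)` on `TQ`. -/
def tangentCoord (w : TangentBundle 𝓘(ℝ, Coord (m + 1)) Q) : Coord (m + 1) × Coord (m + 1) :=
  (e.toOpenPartialHomeomorph w.proj, e.D w.proj w.snd)

/-- The tangent vector with coordinates `(q^μ, q̇^μ)`. -/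
def ofTangentCoord (p : Coord (m + 1) × Coord (m + 1)) : TangentBundle 𝓘(ℝ, Coord (m + 1)) Q :=
  ⟨e.symm p.1, e.Dsymm p.1 p.2⟩

theorem ofTangentCoord_tangentCoord {w : TangentBundle 𝓘(ℝ, Coord (m + 1)) Q}
    (hw : w.proj ∈ e.source) : e.ofTangentCoord (e.tangentCoord w) = w := by
  obtain ⟨q, u⟩ := w
  have h1 : e.Dsymm (e.toOpenPartialHomeomorph q) (e.D q u) = u := e.Dsymm_D hw u
  have h2 : e.symm (e.toOpenPartialHomeomorph q) = q := e.left_inv hw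
  change (⟨e.symm (e.toOpenPartialHomeomorph q),
    e.Dsymm (e.toOpenPartialHomeomorph q) (e.D q u)⟩ : TangentBundle 𝓘(ℝ, Coord (m + 1)) Q) = _
  rw [h1]
  exact congrArg (fun z => (⟨z, (u : Coord (m + 1))⟩ : TangentBundle 𝓘(ℝ, Coord (m + 1)) Q)) h2

theorem tangentCoord_ofTangentCoord {p : Coord (m + 1) × Coord (m + 1)} (hp : p.1 ∈ e.target) :
    e.tangentCoord (e.ofTangentCoord p) = p :=
  Prod.ext (e.right_inv hp) (e.D_Dsymm hp p.2)

theorem isOpen_tangent_source :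
    IsOpen {w : TangentBundle 𝓘(ℝ, Coord (m + 1)) Q | w.proj ∈ e.source} :=
  e.open_source.preimage (FiberBundle.continuous_proj _ _)

theorem contMDiffAt_tangentCoord {w : TangentBundle 𝓘(ℝ, Coord (m + 1)) Q}
    (hw : w.proj ∈ e.source) :
    ContMDiffAt 𝓘(ℝ, Coord (m + 1)).tangent 𝓘(ℝ, Coord (m + 1) × Coord (m + 1)) ∞
      e.tangentCoord w := by
  have h1 := contMDiffAt_tangentMap e.contMDiffOn_toFun e.open_source hw
  have h2 : ContMDiffAt 𝓘(ℝ, Coord (m + 1)).tangent 𝓘(ℝ, Coord (m + 1)) ∞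
      (fun w : TangentBundle 𝓘(ℝ, Coord (m + 1)) Q => e.toOpenPartialHomeomorph w.proj) w :=
    ContMDiffAt.comp w (e.contMDiffAt hw)
      (Bundle.contMDiff_proj (TangentSpace 𝓘(ℝ, Coord (m + 1)))).contMDiffAt
  have h3 := (contMDiff_snd_tangentBundle_modelSpace (Coord (m + 1)) 𝓘(ℝ, Coord (m + 1))
    (n := ∞)).contMDiffAt.comp w h1
  exact h2.prodMk_space h3

theorem contMDiffAt_ofTangentCoord {p : Coord (m + 1) × Coord (m + 1)} (hp : p.1 ∈ e.target) :
    ContMDiffAt 𝓘(ℝ, Coord (m + 1) × Coord (m + 1)) 𝓘(ℝ, Coord (m + 1)).tangent ∞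
      e.ofTangentCoord p :=
  ContMDiffAt.comp p (contMDiffAt_tangentMap e.contMDiffOn_symm e.open_target
    (w := (⟨p.1, p.2⟩ : TangentBundle 𝓘(ℝ, Coord (m + 1)) (Coord (m + 1)))) hp)
    (contMDiff_tangentBundle_mk p)

/-- The inclusion `(t, qⁱ, qⁱₜ) ↦ (t, qⁱ, ṫ = 1, q̇ⁱ = qⁱₜ)`. -/
def imbedCoord (p : Coord (m + 1) × Coord m) : Coord (m + 1) × Coord (m + 1) :=
  (p.1, consCoord (1, p.2))

theorem contDiff_imbedCoord : ContDiff ℝ ∞ (imbedCoord (m := m)) :=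
  contDiff_fst.prodMk (contDiff_consCoord.comp (contDiff_const.prodMk contDiff_snd))

theorem tangentCoord_imbed {v : B.J1} (hv : v.pt ∈ e.source) :
    e.tangentCoord (B.imbed v) = imbedCoord (e.jet v) :=
  Prod.ext rfl (e.D_vec hv)

theorem imbed_eventuallyEq {v : B.J1} (hv : v.pt ∈ e.source) :
    B.imbed =ᶠ[𝓝 v] fun v => e.ofTangentCoord (imbedCoord (e.jet v)) := by
  filter_upwards [e.isOpen_jet_source.mem_nhds hv] with w hw
  rw [← e.tangentCoord_imbed hw, e.ofTangentCoord_tangentCoord hw]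

end Chart

/-! ### The imbedding `λ`, the function `ṫ`, and the retraction of `{ṫ ≠ 0}` onto `J¹Q`. -/

theorem contMDiff_imbed : ContMDiff 𝓘(ℝ, Coord (m + 1) × Coord m) 𝓘(ℝ, Coord (m + 1)).tangent ∞
    B.imbed := by
  intro v
  obtain ⟨e, hv⟩ := B.exists_chart v.pt
  refine ContMDiffAt.congr_of_eventuallyEq ?_ (e.imbed_eventuallyEq hv)
  exact ContMDiffAt.comp v (e.contMDiffAt_ofTangentCoord (p := Chart.imbedCoord (e.jet v))
    (e.map_source hv))
    (ContMDiffAt.comp v Chart.contDiff_imbedCoord.contMDiff.contMDiffAt (e.contMDiffAt_jet hv))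

variable (B) in
/-- The fibre coordinate `ṫ` on `TQ`. -/
def dt (w : TangentBundle 𝓘(ℝ, Coord (m + 1)) Q) : ℝ :=
  mfderiv 𝓘(ℝ, Coord (m + 1)) 𝓘(ℝ, ℝ) B.time w.proj w.snd

theorem Chart.dot_zero (e : B.Chart) {w : TangentBundle 𝓘(ℝ, Coord (m + 1)) Q}
    (hw : w.proj ∈ e.source) : e.dot 0 w = B.dt w :=
  e.D_zero hw w.snd

theorem Chart.contMDiffAt_dot (e : B.Chart) (ν : Fin (m + 1))
    {w : TangentBundle 𝓘(ℝ, Coord (m + 1)) Q} (hw : w.proj ∈ e.source) :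
    ContMDiffAt 𝓘(ℝ, Coord (m + 1)).tangent 𝓘(ℝ, ℝ) ∞ (e.dot ν) w :=
  ((contDiff_coord ν).comp contDiff_snd).contMDiff.contMDiffAt.comp w
    (e.contMDiffAt_tangentCoord hw)

theorem Chart.dot_zero_eventuallyEq (e : B.Chart) {w : TangentBundle 𝓘(ℝ, Coord (m + 1)) Q}
    (hw : w.proj ∈ e.source) : e.dot 0 =ᶠ[𝓝 w] B.dt := by
  filter_upwards [e.isOpen_tangent_source.mem_nhds hw] with y hy
  exact e.dot_zero hy

theorem contMDiff_dt : ContMDiff 𝓘(ℝ, Coord (m + 1)).tangent 𝓘(ℝ, ℝ) ∞ B.dt := by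
  intro w
  obtain ⟨e, hw⟩ := B.exists_chart w.proj
  exact (e.contMDiffAt_dot 0 hw).congr_of_eventuallyEq (e.dot_zero_eventuallyEq hw).symm

theorem dt_imbed (v : B.J1) : B.dt (B.imbed v) = 1 := v.dt_vec

variable (B) in
open Classical in
/-- The retraction `(t, qⁱ, ṫ, q̇ⁱ) ↦ (t, qⁱ, qⁱₜ = q̇ⁱ / ṫ)` of `{ṫ ≠ 0}` onto `J¹Q`. -/
def toJet (w : TangentBundle 𝓘(ℝ, Coord (m + 1)) Q) : B.J1 :=
  if h : B.dt w = 0 then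
    -- Junk value making the map total; only the behaviour on the open set `{ṫ ≠ 0}` matters.
    let e := (B.exists_chart w.proj).choose
    e.jet.symm (e.toOpenPartialHomeomorph w.proj, 0)
  else ⟨w.proj, (B.dt w)⁻¹ • w.snd, (map_smul _ _ _).trans (inv_mul_cancel₀ h)⟩

theorem toJet_of_ne_zero {w : TangentBundle 𝓘(ℝ, Coord (m + 1)) Q} (h : B.dt w ≠ 0) :
    B.toJet w = ⟨w.proj, (B.dt w)⁻¹ • w.snd, (map_smul _ _ _).trans (inv_mul_cancel₀ h)⟩ :=
  dif_neg h

theorem toJet_imbed (v : B.J1) : B.toJet (B.imbed v) = v := by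
  rw [toJet_of_ne_zero (by simp [dt_imbed])]
  refine J1.ext rfl ?_
  change (B.dt (B.imbed v))⁻¹ • v.vec = v.vec
  rw [dt_imbed, inv_one, one_smul]

theorem isOpen_dt_ne_zero : IsOpen {w : TangentBundle 𝓘(ℝ, Coord (m + 1)) Q | B.dt w ≠ 0} :=
  isOpen_ne_fun contMDiff_dt.continuous continuous_const

theorem pt_toJet_eventuallyEq {w : TangentBundle 𝓘(ℝ, Coord (m + 1)) Q} (h : B.dt w ≠ 0) :
    (fun w => (B.toJet w).pt) =ᶠ[𝓝 w] Bundle.TotalSpace.proj := by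
  filter_upwards [isOpen_dt_ne_zero.mem_nhds h] with y hy
  rw [toJet_of_ne_zero hy]

theorem Chart.velVec_toJet (e : B.Chart) {w : TangentBundle 𝓘(ℝ, Coord (m + 1)) Q}
    (h : B.dt w ≠ 0) : e.velVec (B.toJet w) = (B.dt w)⁻¹ • tailCoord (e.D w.proj w.snd) := by
  rw [toJet_of_ne_zero h]
  change tailCoord (e.D w.proj ((B.dt w)⁻¹ • w.snd)) = _
  rw [map_smul]
  rfl

theorem contMDiffAt_toJet {w : TangentBundle 𝓘(ℝ, Coord (m + 1)) Q} (h : B.dt w ≠ 0) :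
    ContMDiffAt 𝓘(ℝ, Coord (m + 1)).tangent 𝓘(ℝ, Coord (m + 1) × Coord m) ∞ B.toJet w := by
  obtain ⟨e, hw⟩ := B.exists_chart w.proj
  have h1 : ContMDiffAt 𝓘(ℝ, Coord (m + 1)).tangent 𝓘(ℝ, Coord (m + 1) × Coord m) ∞
      (fun w => ((e.tangentCoord w).1, (B.dt w)⁻¹ • tailCoord (e.tangentCoord w).2)) w :=
    (contDiff_fst.contMDiff.contMDiffAt.comp w (e.contMDiffAt_tangentCoord hw)).prodMk_space
      ((contMDiff_dt.contMDiffAt.inv₀ h).smul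
        ((contDiff_tailCoord.comp contDiff_snd).contMDiff.contMDiffAt.comp w
          (e.contMDiffAt_tangentCoord hw)))
  refine (ContMDiffAt.comp w (e.contMDiffAt_jet_symm
    (p := ((e.tangentCoord w).1, (B.dt w)⁻¹ • tailCoord (e.tangentCoord w).2))
    (e.map_source hw)) h1).congr_of_eventuallyEq ?_
  filter_upwards [isOpen_dt_ne_zero.mem_nhds h, e.isOpen_tangent_source.mem_nhds hw] with y hy hy'
  have hs : B.toJet y ∈ e.jet.source := by
    rw [toJet_of_ne_zero hy]
    exact hy'
  have hc : e.jet (B.toJet y) =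
      ((e.tangentCoord y).1, (B.dt y)⁻¹ • tailCoord (e.tangentCoord y).2) := by
    refine Prod.ext ?_ (e.velVec_toJet hy)
    rw [toJet_of_ne_zero hy]
    rfl
  exact (e.jet.left_inv hs).symm.trans (congrArg e.jet.symm hc)

end ConfigurationBundle

/-! ### The chain rule applied to vectors. -/

section Derivative

variable {E H E' H' E'' H'' M M' M'' : Type*}
  [NormedAddCommGroup E] [NormedSpace ℝ E] [TopologicalSpace H] {I : ModelWithCorners ℝ E H}
  [NormedAddCommGroup E'] [NormedSpace ℝ E'] [TopologicalSpace H'] {I' : ModelWithCorners ℝ E' H'}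
  [NormedAddCommGroup E''] [NormedSpace ℝ E''] [TopologicalSpace H'']
  {I'' : ModelWithCorners ℝ E'' H''}
  [TopologicalSpace M] [ChartedSpace H M] [TopologicalSpace M'] [ChartedSpace H' M']
  [TopologicalSpace M''] [ChartedSpace H'' M'']

/-- With vectors taken in the model spaces, `f x = y` may be a propositional equality. This is
needed for round trips such as `toJet (imbed v) = v`. -/
theorem mfderiv_comp_apply_of_eq_point {f : M → M'} {g : M' → M''} {x : M} {y : M'}
    (hy : f x = y) (hg : MDifferentiableAt I' I'' g y) (hf : MDifferentiableAt I I' f x) (u : E) :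
    (mfderiv I I'' (fun z => g (f z)) x : E →L[ℝ] E'') u =
      (mfderiv I' I'' g y : E' →L[ℝ] E'') ((mfderiv I I' f x : E →L[ℝ] E') u) := by
  exact mfderiv_comp_apply_of_eq x hg hf hy u

theorem mfderiv_clm_comp_apply {f : M → E'} {x : M} (L : E' →L[ℝ] E'')
    (hf : MDifferentiableAt I 𝓘(ℝ, E') f x) (u : E) :
    (mfderiv I 𝓘(ℝ, E'') (fun z => L (f z)) x : E →L[ℝ] E'') u =
      L ((mfderiv I 𝓘(ℝ, E') f x : E →L[ℝ] E') u) := by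
  rw [mfderiv_comp_apply_of_eq_point (g := L) rfl L.mdifferentiableAt hf,
    mfderiv_eq_fderiv, L.fderiv]
  rfl

end Derivative

namespace ConfigurationBundle

variable {m : ℕ} {Q M : Type*}
  [TopologicalSpace Q] [ChartedSpace (Coord (m + 1)) Q]
  [TopologicalSpace M] [ChartedSpace (Coord m) M]
  {B : ConfigurationBundle m Q M}
  [IsManifold 𝓘(ℝ, Coord m) ∞ M]

variable [IsManifold 𝓘(ℝ, Coord (m + 1)) ∞ Q]

/-! ### Tangent vectors in coordinates -/

namespace Chart

variable (e : B.Chart)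

theorem sum_partialVec {q : Q} (hq : q ∈ e.source) (u : TangentSpace 𝓘(ℝ, Coord (m + 1)) q) :
    ∑ μ, e.D q u μ • e.partialVec μ q = u := by
  conv_rhs => rw [← e.Dsymm_D hq u]
  have h : e.D q u = ∑ μ, e.D q u μ • EuclideanSpace.single μ (1 : ℝ) := by
    ext j
    simp [Pi.single_apply]
  conv_rhs => rw [h]
  rw [map_sum]
  exact Finset.sum_congr rfl fun μ _ => (map_smul _ _ _).symm

/-- The coefficient of `∂ₜ` is `1` because a jet projects onto `∂ₜ`. Contracting a connection with
this vector produces the shape `(·)₀ + qʲₜ (·)ⱼ`. -/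
theorem vec_eq {v : B.J1} (hv : v.pt ∈ e.source) :
    v.vec = e.partialVec 0 v.pt + ∑ j : Fin m, e.vel j v • e.partialVec j.succ v.pt := by
  conv_lhs => rw [← e.sum_partialVec hv v.vec, Fin.sum_univ_succ, e.D_zero hv, v.dt_vec, one_smul]
  rfl

theorem mfderiv_vel {v : B.J1} (hv : v.pt ∈ e.source) (i : Fin m)
    (X : TangentSpace 𝓘(ℝ, Coord (m + 1) × Coord m) v) :
    mfderiv 𝓘(ℝ, Coord (m + 1) × Coord m) 𝓘(ℝ, ℝ) (e.vel i) v X =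
      EuclideanSpace.proj (𝕜 := ℝ) i
        (mfderiv 𝓘(ℝ, Coord (m + 1) × Coord m) 𝓘(ℝ, Coord m) e.velVec v X) :=
  mfderiv_clm_comp_apply (EuclideanSpace.proj (𝕜 := ℝ) i)
    ((e.contMDiffAt_velVec hv).mdifferentiableAt (by simp)) X

theorem mfderiv_jet {v : B.J1} (hv : v.pt ∈ e.source)
    (X : TangentSpace 𝓘(ℝ, Coord (m + 1) × Coord m) v) :
    mfderiv 𝓘(ℝ, Coord (m + 1) × Coord m) 𝓘(ℝ, Coord (m + 1) × Coord m) e.jet v X =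
      (e.D v.pt (mfderiv 𝓘(ℝ, Coord (m + 1) × Coord m) 𝓘(ℝ, Coord (m + 1)) J1.pt v X),
        mfderiv 𝓘(ℝ, Coord (m + 1) × Coord m) 𝓘(ℝ, Coord m) e.velVec v X) := by
  have hj := (e.contMDiffAt_jet hv).mdifferentiableAt (by simp)
  refine Prod.ext ?_ ?_
  · refine (mfderiv_clm_comp_apply (ContinuousLinearMap.fst ℝ _ _) hj X).symm.trans ?_
    exact mfderiv_comp_apply_of_eq_point (f := J1.pt) rfl (e.mdifferentiable.mdifferentiableAt hv)
      (contMDiff_pt.contMDiffAt.mdifferentiableAt (by simp)) X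
  · exact (mfderiv_clm_comp_apply (ContinuousLinearMap.snd ℝ _ _) hj X).symm

/-- The two kinds of data are the components of the derivative of the jet chart, which is injective.
Both uniqueness assertions rest on this. -/
theorem jet_tangent_ext {v : B.J1} (hv : v.pt ∈ e.source)
    {X Y : TangentSpace 𝓘(ℝ, Coord (m + 1) × Coord m) v}
    (h1 : mfderiv 𝓘(ℝ, Coord (m + 1) × Coord m) 𝓘(ℝ, Coord (m + 1)) J1.pt v X =
      mfderiv 𝓘(ℝ, Coord (m + 1) × Coord m) 𝓘(ℝ, Coord (m + 1)) J1.pt v Y)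
    (h2 : ∀ i, mfderiv 𝓘(ℝ, Coord (m + 1) × Coord m) 𝓘(ℝ, ℝ) (e.vel i) v X =
      mfderiv 𝓘(ℝ, Coord (m + 1) × Coord m) 𝓘(ℝ, ℝ) (e.vel i) v Y) : X = Y := by
  have hd := mdifferentiable_of_mem_atlas (I := 𝓘(ℝ, Coord (m + 1) × Coord m)) e.jetChart_mem_atlas
  apply hd.mfderiv_injective hv
  refine (e.mfderiv_jet hv X).trans (Eq.trans ?_ (e.mfderiv_jet hv Y).symm)
  refine Prod.ext (congrArg (e.D v.pt) h1) (PiLp.ext fun i => ?_)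
  exact (e.mfderiv_vel hv i X).symm.trans ((h2 i).trans (e.mfderiv_vel hv i Y))

/-- On vectors annihilated by `dṫ`, the tangent map of the retraction `TQ → J¹Q` at a point of
`J¹Q` turns `∂/∂q̇ⁱ`-components into `∂ᵢᵗ`-components. -/
theorem mfderiv_vel_toJet {v : B.J1} (hv : v.pt ∈ e.source) (i : Fin m)
    {Z : TangentSpace 𝓘(ℝ, Coord (m + 1)).tangent (B.imbed v)}
    (hZ : mfderiv 𝓘(ℝ, Coord (m + 1)).tangent 𝓘(ℝ, ℝ) B.dt (B.imbed v) Z = (0 : ℝ)) :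
    (mfderiv 𝓘(ℝ, Coord (m + 1) × Coord m) 𝓘(ℝ, ℝ) (e.vel i) v :
        Coord (m + 1) × Coord m →L[ℝ] ℝ)
      ((mfderiv 𝓘(ℝ, Coord (m + 1)).tangent 𝓘(ℝ, Coord (m + 1) × Coord m) B.toJet (B.imbed v) :
        Coord (m + 1) × Coord (m + 1) →L[ℝ] Coord (m + 1) × Coord m) Z) =
      mfderiv 𝓘(ℝ, Coord (m + 1)).tangent 𝓘(ℝ, ℝ) (e.dot i.succ) (B.imbed v) Z := by
  have h0 : B.dt (B.imbed v) ≠ 0 := by simp [dt_imbed]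
  have hvel : ContMDiffAt 𝓘(ℝ, Coord (m + 1) × Coord m) 𝓘(ℝ, ℝ) ∞ (e.vel i) v :=
    (contDiff_coord i).contMDiff.contMDiffAt.comp v (e.contMDiffAt_velVec hv)
  have ht := (contMDiffAt_toJet h0).mdifferentiableAt (by simp)
  refine (mfderiv_comp_apply_of_eq_point (toJet_imbed v) (hvel.mdifferentiableAt (by simp))
    ht Z).symm.trans ?_
  have hc : MDifferentiableAt 𝓘(ℝ, Coord (m + 1)).tangent 𝓘(ℝ, ℝ)
      (fun w => e.vel i (B.toJet w)) (B.imbed v) :=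
    MDifferentiableAt.comp (g := e.vel i) (f := B.toJet) (B.imbed v)
      (by rw [toJet_imbed]; exact hvel.mdifferentiableAt (by simp)) ht
  have hd : MDifferentiableAt 𝓘(ℝ, Coord (m + 1)).tangent 𝓘(ℝ, ℝ) B.dt (B.imbed v) :=
    contMDiff_dt.contMDiffAt.mdifferentiableAt (by simp)
  -- Near `λ(v)` one has `q̇ⁱ = ṫ · (qⁱₜ ∘ toJet)`. In the Leibniz rule the factor `ṫ` is `1` at
  -- `λ(v)`, and the term with `dṫ(Z)` vanishes.
  have heq : e.dot i.succ =ᶠ[𝓝 (B.imbed v)] B.dt * fun w => e.vel i (B.toJet w) := by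
    filter_upwards [isOpen_dt_ne_zero.mem_nhds h0] with w hw
    have : e.vel i (B.toJet w) = (B.dt w)⁻¹ * e.dot i.succ w :=
      congrArg (fun y : Coord m => y i) (e.velVec_toJet hw)
    simp only [Pi.mul_apply, this, mul_inv_cancel_left₀ hw]
  have hm := (hd.hasMFDerivAt.mul hc.hasMFDerivAt).mfderiv
  rw [heq.mfderiv_eq]
  refine Eq.trans ?_ (DFunLike.congr_fun hm Z).symm
  have aux : ∀ a b c d : ℝ, c = 1 → d = 0 → b = c * b + a * d := by
    rintro a b c d rfl rfl
    simp
  exact aux _ _ _ _ (dt_imbed v) hZ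

end Chart

end ConfigurationBundle

namespace ConfigurationBundle

variable {m : ℕ} {Q M : Type*}
  [TopologicalSpace Q] [ChartedSpace (Coord (m + 1)) Q]
  [TopologicalSpace M] [ChartedSpace (Coord m) M]
  {B : ConfigurationBundle m Q M}
  [IsManifold 𝓘(ℝ, Coord m) ∞ M]

variable [IsManifold 𝓘(ℝ, Coord (m + 1)) ∞ Q]

/-! ### From connections on `TQ → Q` to dynamic connections and dynamic equations -/

namespace TangentConnection

variable (K : B.TangentConnection)

/-- Since `ṫ` does not depend on the chart, one chart around the base point and linearity over the
vectors `∂_μ` suffice. -/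
theorem mfderiv_dt_lift (hK : K.TimeComponentsVanish)
    (w : TangentBundle 𝓘(ℝ, Coord (m + 1)) Q) (u : TangentSpace 𝓘(ℝ, Coord (m + 1)) w.proj) :
    mfderiv 𝓘(ℝ, Coord (m + 1)).tangent 𝓘(ℝ, ℝ) B.dt w (K.lift w u) = (0 : ℝ) := by
  obtain ⟨e, hw⟩ := B.exists_chart w.proj
  rw [← e.sum_partialVec hw u, map_sum, map_sum]
  refine Finset.sum_eq_zero fun μ _ => ?_
  have h : mfderiv 𝓘(ℝ, Coord (m + 1)).tangent 𝓘(ℝ, ℝ) (e.dot 0) w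
      (K.lift w (e.partialVec μ w.proj)) = (0 : ℝ) := hK e w hw μ
  rw [(e.dot_zero_eventuallyEq hw).mfderiv_eq] at h
  rw [map_smul, map_smul]
  exact (congrArg (fun z : ℝ => e.D w.proj u μ • z) h).trans (smul_zero _)

/-- The horizontal lift `T_vQ → T_vJ¹Q` given by a connection on `TQ → Q` along `J¹Q`. -/
def jetLift (v : B.J1) : TangentSpace 𝓘(ℝ, Coord (m + 1)) v.pt →L[ℝ]
    TangentSpace 𝓘(ℝ, Coord (m + 1) × Coord m) v :=
  (mfderiv 𝓘(ℝ, Coord (m + 1)).tangent 𝓘(ℝ, Coord (m + 1) × Coord m) B.toJet (B.imbed v) :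
    Coord (m + 1) × Coord (m + 1) →L[ℝ] Coord (m + 1) × Coord m) ∘L
  (K.lift (B.imbed v) : Coord (m + 1) →L[ℝ] Coord (m + 1) × Coord (m + 1))

/-- The retraction covers the identity of `Q`, so its tangent map preserves the projection to `TQ`.
The condition `K⁰_μ = 0` plays no role here. -/
theorem mfderiv_pt_jetLift (v : B.J1) (u : TangentSpace 𝓘(ℝ, Coord (m + 1)) v.pt) :
    mfderiv 𝓘(ℝ, Coord (m + 1) × Coord m) 𝓘(ℝ, Coord (m + 1)) J1.pt v (K.jetLift v u) = u := by
  have h0 : B.dt (B.imbed v) ≠ 0 := by simp [dt_imbed]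
  refine (mfderiv_comp_apply_of_eq_point (toJet_imbed v)
    (contMDiff_pt.contMDiffAt.mdifferentiableAt (by simp))
    ((contMDiffAt_toJet h0).mdifferentiableAt (by simp)) _).symm.trans ?_
  refine Eq.trans ?_ (K.proj_lift (B.imbed v) u)
  exact DFunLike.congr_fun (pt_toJet_eventuallyEq h0).mfderiv_eq (K.lift (B.imbed v) u)

theorem contMDiffAt_jetLift (v₀ : B.J1) :
    ContMDiffAt 𝓘(ℝ, Coord (m + 1) × Coord m)
      𝓘(ℝ, Coord (m + 1) →L[ℝ] Coord (m + 1) × Coord m) ∞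
      (inTangentCoordinates 𝓘(ℝ, Coord (m + 1)) 𝓘(ℝ, Coord (m + 1) × Coord m) J1.pt id
        (fun v => K.jetLift v) v₀) v₀ := by
  have h0 : B.dt (B.imbed v₀) ≠ 0 := by simp [dt_imbed]
  have h1 := (K.smooth (B.imbed v₀)).comp v₀ contMDiff_imbed.contMDiffAt
  have h2 := contMDiffAt_inTangentCoordinates_mfderiv_comp (contMDiffAt_toJet h0)
    contMDiff_imbed.contMDiffAt (f := J1.pt) (ϕ := fun v => K.lift (B.imbed v)) h1
  exact contMDiffAt_inTangentCoordinates_congr h2 Filter.EventuallyEq.rfl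
    (Filter.Eventually.of_forall fun v => (toJet_imbed v).symm) Filter.EventuallyEq.rfl

theorem mfderiv_vel_jetLift (hK : K.TimeComponentsVanish) (e : B.Chart) {v : B.J1}
    (hv : v.pt ∈ e.source) (i : Fin m) (u : TangentSpace 𝓘(ℝ, Coord (m + 1)) v.pt) :
    mfderiv 𝓘(ℝ, Coord (m + 1) × Coord m) 𝓘(ℝ, ℝ) (e.vel i) v (K.jetLift v u) =
      mfderiv 𝓘(ℝ, Coord (m + 1)).tangent 𝓘(ℝ, ℝ) (e.dot i.succ) (B.imbed v)
        (K.lift (B.imbed v) u) :=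
  e.mfderiv_vel_toJet hv i (K.mfderiv_dt_lift hK (B.imbed v) u)

/-- The dynamic connection `γⁱ_μ = Kⁱ_μ ∘ λ`. -/
def toDynamicConnection : B.DynamicConnection where
  lift := K.jetLift
  proj_lift := K.mfderiv_pt_jetLift
  smooth := K.contMDiffAt_jetLift

theorem restrictsTo_toDynamicConnection (hK : K.TimeComponentsVanish) :
    K.RestrictsTo K.toDynamicConnection :=
  fun e _ hv i μ => K.mfderiv_vel_jetLift hK e hv i (e.partialVec μ _)

end TangentConnection

/-- In bundle coordinates the velocity is `(1, q¹ₜ, …, qᵐₜ)`, which is smooth on `J¹Q`; the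
derivative of the inverse chart carries it back to `TQ`. -/
theorem contMDiffAt_inTangentCoordinates_vec (v₀ : B.J1) :
    ContMDiffAt 𝓘(ℝ, Coord (m + 1) × Coord m) 𝓘(ℝ, ℝ →L[ℝ] Coord (m + 1)) ∞
      (inTangentCoordinates 𝓘(ℝ, ℝ) 𝓘(ℝ, Coord (m + 1)) (fun v : B.J1 => B.time v.pt) J1.pt
        (fun v => ContinuousLinearMap.toSpanSingleton ℝ (v.vec : Coord (m + 1))) v₀) v₀ := by
  obtain ⟨e, hv⟩ := B.exists_chart v₀.pt
  have h1 : ContMDiffAt 𝓘(ℝ, Coord (m + 1) × Coord m) 𝓘(ℝ, ℝ →L[ℝ] Coord (m + 1)) ∞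
      (fun v => ContinuousLinearMap.toSpanSingleton ℝ (consCoord (1, e.velVec v))) v₀ :=
    (((ContinuousLinearMap.toSpanSingletonCLE (𝕜 := ℝ) (E := Coord (m + 1))).contDiff.comp
      (contDiff_consCoord.comp (contDiff_const.prodMk contDiff_id))).contMDiff.contMDiffAt).comp v₀
      (e.contMDiffAt_velVec hv)
  have h2 := contMDiffAt_inTangentCoordinates_mfderiv_comp (S := e.toOpenPartialHomeomorph.symm)
    (g := fun v : B.J1 => e.toOpenPartialHomeomorph v.pt) (x₀ := v₀)
    (f := fun v : B.J1 => B.time v.pt)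
    (e.contMDiffAt_symm (e.map_source hv))
    ((e.contMDiffAt hv).comp v₀ contMDiff_pt.contMDiffAt)
    (contMDiffAt_inTangentCoordinates_vectorSpace.2 h1)
  refine contMDiffAt_inTangentCoordinates_congr h2 Filter.EventuallyEq.rfl ?_ ?_
  · filter_upwards [e.isOpen_jet_source.mem_nhds hv] with v hv
    exact (e.left_inv hv).symm
  · filter_upwards [e.isOpen_jet_source.mem_nhds hv] with v hv
    ext1
    refine (one_smul ℝ _).trans (Eq.trans ?_ (congrArg (e.Dsymm _) (one_smul ℝ _).symm))
    exact (e.Dsymm_D hv v.vec).symm.trans (congrArg (e.Dsymm _) (e.D_vec hv))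

/-- The dynamic equation `qⁱₜₜ = γⁱ₀ + qʲₜ γⁱⱼ` of a dynamic connection. -/
def DynamicConnection.toDynamicEquation (γ : B.DynamicConnection) : B.DynamicEquation where
  -- The value at `∂ₜ` is the `γ`-lift of the velocity. Holonomy is then the right-inverse property
  -- of `γ`, and the projection to time is the identity because the velocity has `ṫ = 1`.
  lift v := (γ.lift v : Coord (m + 1) →L[ℝ] Coord (m + 1) × Coord m) ∘L
    ContinuousLinearMap.toSpanSingleton ℝ (v.vec : Coord (m + 1))
  proj_lift v := fun (s : ℝ) => by
    refine (mfderiv_comp_apply_of_eq_point rfl (contMDiff_time.contMDiffAt.mdifferentiableAt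
      (by simp)) (contMDiff_pt.contMDiffAt.mdifferentiableAt (by simp)) _).trans ?_
    refine (congrArg _ (γ.proj_lift v (s • v.vec))).trans ?_
    refine (map_smul _ _ _).trans ?_
    exact (congrArg (fun z : ℝ => s * z) v.dt_vec).trans (mul_one s)
  smooth v₀ := contMDiffAt_inTangentCoordinates_comp (γ.smooth v₀)
    (contMDiffAt_inTangentCoordinates_vec v₀) contMDiff_pt.continuous.continuousAt
  holonomic v := (γ.proj_lift v _).trans (one_smul ℝ v.vec)

theorem DynamicConnection.yields_toDynamicEquation (γ : B.DynamicConnection) :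
    γ.Yields γ.toDynamicEquation := by
  intro e v hv i
  have h1 : γ.toDynamicEquation.lift v (1 : ℝ) = γ.lift v v.vec :=
    congrArg (γ.lift v) (one_smul ℝ v.vec)
  have h2 : γ.lift v v.vec = γ.lift v (e.partialVec 0 v.pt) +
      ∑ j : Fin m, e.vel j v • γ.lift v (e.partialVec j.succ v.pt) := by
    conv_lhs => rw [e.vec_eq hv]
    simp only [map_add, map_sum, map_smul]
  rw [DynamicEquation.comp, h1, h2]
  simp only [map_add, map_sum, map_smul]
  rfl

theorem TangentConnection.RestrictsTo.hasForm_iff_yields {K : B.TangentConnection}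
    {γ : B.DynamicConnection} (h : K.RestrictsTo γ) (ξ : B.DynamicEquation) :
    ξ.HasForm K ↔ γ.Yields ξ := by
  refine forall_congr' fun e => forall_congr' fun v => forall_congr' fun hv =>
    forall_congr' fun i => ?_
  simp only [h e v hv]

theorem DynamicConnection.ext_comp {γ γ' : B.DynamicConnection}
    (h : ∀ (e : B.Chart) (v : B.J1), v.pt ∈ e.source → ∀ (i : Fin m) (μ : Fin (m + 1)),
      γ.comp e i μ v = γ'.comp e i μ v) : γ = γ' := by
  have hl : γ.lift = γ'.lift := by
    funext v
    obtain ⟨e, hv⟩ := B.exists_chart v.pt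
    ext1 u
    rw [← e.sum_partialVec hv u, map_sum, map_sum]
    refine Finset.sum_congr rfl fun μ _ => ?_
    rw [map_smul, map_smul]
    refine congrArg _ (e.jet_tangent_ext hv ?_ fun i => h e v hv i μ)
    exact (γ.proj_lift v _).trans (γ'.proj_lift v _).symm
  cases γ
  cases γ'
  cases hl
  rfl

/-- A lift from `ℝ` is determined by its value at `1`. Holonomy fixes the projection of that value
to `Q`, leaving only the `ξⁱ` free. -/
theorem DynamicEquation.ext_comp {ξ ξ' : B.DynamicEquation}
    (h : ∀ (e : B.Chart) (v : B.J1), v.pt ∈ e.source → ∀ i : Fin m,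
      ξ.comp e i v = ξ'.comp e i v) : ξ = ξ' := by
  have hl : ξ.lift = ξ'.lift := by
    funext v
    obtain ⟨e, hv⟩ := B.exists_chart v.pt
    refine ContinuousLinearMap.ext_ring ?_
    exact e.jet_tangent_ext hv ((ξ.holonomic v).trans (ξ'.holonomic v).symm) fun i => h e v hv i
  obtain ⟨⟨_, _, _⟩, _⟩ := ξ
  obtain ⟨⟨_, _, _⟩, _⟩ := ξ'
  cases hl
  rfl

end ConfigurationBundle

/-! ### Gluing connections -/

section Glue

variable {EX HX EY HY X Y ι : Type*}
  [NormedAddCommGroup EX] [NormedSpace ℝ EX] [TopologicalSpace HX]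
  [NormedAddCommGroup EY] [NormedSpace ℝ EY] [TopologicalSpace HY]
  [TopologicalSpace X] [ChartedSpace HX X] [TopologicalSpace Y] [ChartedSpace HY Y]
  {IX : ModelWithCorners ℝ EX HX} {IY : ModelWithCorners ℝ EY HY}
  [IsManifold IX 1 X] [IsManifold IY 1 Y] {p : Y → X}

/-- Local connections are glued by a smooth partition of unity on the base. -/
def Connection.glue (hp : ContMDiff IY IX ∞ p) (ρ : SmoothPartitionOfUnity ι IX X)
    (L : ι → ∀ y : Y, TangentSpace IX (p y) →L[ℝ] TangentSpace IY y)
    (hL : ∀ i y, p y ∈ tsupport (ρ i) → ∀ u, mfderiv IY IX p y (L i y u) = u)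
    (hs : ∀ i y₀, p y₀ ∈ tsupport (ρ i) → ContMDiffAt IY 𝓘(ℝ, EX →L[ℝ] EY) ∞
      (inTangentCoordinates IX IY p id (fun y => L i y) y₀) y₀) : Connection IX IY p where
  lift y := ∑ i ∈ ρ.finsupport (p y), ρ i (p y) • L i y
  proj_lift y u := by
    have h : ∀ i ∈ ρ.finsupport (p y),
        mfderiv IY IX p y ((ρ i (p y) • L i y) u) = ρ i (p y) • u := by
      intro i hi
      have hy : p y ∈ tsupport (ρ i) := (ρ.mem_fintsupport_iff (p y) i).1
        (ρ.finsupport_subset_fintsupport (p y) hi)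
      rw [smul_apply, map_smul, hL i y hy]
    -- Being a right inverse is an affine condition, so it persists because the weights sum to one.
    rw [sum_apply, map_sum, Finset.sum_congr rfl h, ← Finset.sum_smul,
      ρ.sum_finsupport (p y) (mem_univ _), one_smul]
  smooth y₀ := by
    -- The index set of the defining sum varies with `y`. Near `y₀` it lies in this fixed finite
    -- set, and the additional terms have weight zero.
    have h1 : ContMDiffAt IY 𝓘(ℝ, EX →L[ℝ] EY) ∞ (fun y => ∑ i ∈ ρ.fintsupport (p y₀),
        ρ i (p y) • inTangentCoordinates IX IY p id (fun y => L i y) y₀ y) y₀ := by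
      refine ContMDiffAt.sum fun i hi => ?_
      exact ((ρ i).contMDiff.contMDiffAt.comp y₀ hp.contMDiffAt).smul
        (hs i y₀ ((ρ.mem_fintsupport_iff (p y₀) i).1 hi))
    have h2 : ContMDiffAt IY 𝓘(ℝ, EX →L[ℝ] EY) ∞ (inTangentCoordinates IX IY p id
        (fun y => ∑ i ∈ ρ.fintsupport (p y₀), ρ i (p y) • (L i y : EX →L[ℝ] EY)) y₀) y₀ := by
      refine h1.congr_of_eventuallyEq (Filter.Eventually.of_forall fun y => ?_)
      exact inTangentCoordinates_sum_smul _ (fun i y => ρ i (p y)) (fun i y => L i y) y₀ y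
    refine contMDiffAt_inTangentCoordinates_congr h2 Filter.EventuallyEq.rfl
      Filter.EventuallyEq.rfl ?_
    filter_upwards [hp.continuous.continuousAt.eventually
      (ρ.eventually_finsupport_subset (p y₀))] with y hy
    refine Finset.sum_subset hy fun i _ hi => ?_
    have : ρ i (p y) = 0 := by simpa using hi
    exact (congrArg (fun c : ℝ => c • (L i y : EX →L[ℝ] EY)) this).trans (zero_smul ℝ _)

end Glue

namespace ConfigurationBundle

variable {m : ℕ} {Q M : Type*}
  [TopologicalSpace Q] [ChartedSpace (Coord (m + 1)) Q]
  [TopologicalSpace M] [ChartedSpace (Coord m) M]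
  {B : ConfigurationBundle m Q M}
  [IsManifold 𝓘(ℝ, Coord m) ∞ M]

variable [IsManifold 𝓘(ℝ, Coord (m + 1)) ∞ Q]

/-! ### From dynamic equations to connections on `TQ → Q` -/

/-- The linear map `(y¹, …, yᵐ) ↦ (0, y¹, …, yᵐ)`. -/
def consZero (m : ℕ) : Coord m →L[ℝ] Coord (m + 1) where
  toFun y := consCoord (0, y)
  map_add' y z := by
    ext i
    refine Fin.cases ?_ (fun j => ?_) i <;> simp
  map_smul' c y := by
    ext i
    refine Fin.cases ?_ (fun j => ?_) i <;> simp
  cont := contDiff_consCoord.continuous.comp (continuous_const.prodMk continuous_id)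

/-- The map is affine: the constant entry `ṫ = 1` becomes `0` in the derivative. -/
theorem fderiv_imbedCoord (p : Coord (m + 1) × Coord m) (a : Coord (m + 1) × Coord m) :
    fderiv ℝ Chart.imbedCoord p a = (a.1, consZero m a.2) := by
  have h : Chart.imbedCoord (m := m) = fun p : Coord (m + 1) × Coord m =>
      ((ContinuousLinearMap.fst ℝ _ _).prod ((consZero m).comp (ContinuousLinearMap.snd ℝ _ _))) p +
        (0, consCoord (1, 0)) := by
    funext p
    refine Prod.ext (add_zero _).symm ?_
    ext i
    refine Fin.cases ?_ (fun j => ?_) i <;> simp [Chart.imbedCoord, consZero]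
  rw [h, fderiv_add_const, ContinuousLinearMap.fderiv]
  rfl

namespace DynamicEquation

variable (ξ : B.DynamicEquation) (e : B.Chart)

/-- The vector of the components `ξⁱ`. -/
def acc (v : B.J1) : Coord m :=
  (mfderiv 𝓘(ℝ, Coord (m + 1) × Coord m) 𝓘(ℝ, Coord m) e.velVec v :
    Coord (m + 1) × Coord m →L[ℝ] Coord m) (ξ.lift v (1 : ℝ))

theorem contMDiffAt_acc {v : B.J1} (hv : v.pt ∈ e.source) :
    ContMDiffAt 𝓘(ℝ, Coord (m + 1) × Coord m) 𝓘(ℝ, Coord m) ∞ (ξ.acc e) v := by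
  have h := contMDiffAt_inTangentCoordinates_mfderiv_comp (g := id) (x₀ := v)
    (f := fun v : B.J1 => B.time v.pt) (e.contMDiffAt_velVec hv) contMDiffAt_id (ξ.smooth v)
  exact (contMDiffAt_inTangentCoordinates_vectorSpace.1 h).clm_apply contMDiffAt_const

/-- The lift `a^μ ∂_μ ↦ a^μ ∂_μ + a⁰ ξⁱ(q^μ, q̇ʲ) ∂/∂q̇ⁱ` in coordinates. -/
def localLiftCoord (w : TangentBundle 𝓘(ℝ, Coord (m + 1)) Q) :
    Coord (m + 1) →L[ℝ] Coord (m + 1) × Coord (m + 1) :=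
  (ContinuousLinearMap.id ℝ _).prod ((EuclideanSpace.proj (𝕜 := ℝ) (0 : Fin (m + 1))).smulRight
    -- The coordinate `ṫ` is discarded rather than divided by, so the lift is also smooth across `ṫ
    -- = 0`. On `λ(J¹Q)` the jet read off is the given one.
    (consZero m (ξ.acc e (e.jet.symm ((e.tangentCoord w).1, tailCoord (e.tangentCoord w).2)))))

/-- The local connection on `TQ → Q` with `Kⁱ₀(q^μ, q̇ʲ) = ξⁱ(q^μ, q̇ʲ)` and `Kⁱⱼ = 0`. -/
def localLift (w : TangentBundle 𝓘(ℝ, Coord (m + 1)) Q) :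
    TangentSpace 𝓘(ℝ, Coord (m + 1)) w.proj →L[ℝ]
      TangentSpace 𝓘(ℝ, Coord (m + 1)).tangent w :=
  (mfderiv 𝓘(ℝ, Coord (m + 1) × Coord (m + 1)) 𝓘(ℝ, Coord (m + 1)).tangent e.ofTangentCoord
    (e.tangentCoord w) :
      Coord (m + 1) × Coord (m + 1) →L[ℝ] Coord (m + 1) × Coord (m + 1)) ∘L
  ξ.localLiftCoord e w ∘L (e.D w.proj : Coord (m + 1) →L[ℝ] Coord (m + 1))

variable {e}

theorem contMDiffAt_localLiftCoord {w : TangentBundle 𝓘(ℝ, Coord (m + 1)) Q}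
    (hw : w.proj ∈ e.source) :
    ContMDiffAt 𝓘(ℝ, Coord (m + 1)).tangent
      𝓘(ℝ, Coord (m + 1) →L[ℝ] Coord (m + 1) × Coord (m + 1)) ∞ (ξ.localLiftCoord e) w := by
  have ht := e.contMDiffAt_tangentCoord hw
  have h1 : ContMDiffAt 𝓘(ℝ, Coord (m + 1)).tangent 𝓘(ℝ, Coord (m + 1) × Coord m) ∞
      (fun w => ((e.tangentCoord w).1, tailCoord (e.tangentCoord w).2)) w :=
    (contDiff_fst.prodMk (contDiff_tailCoord.comp contDiff_snd)).contMDiff.contMDiffAt.comp w ht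
  have hx : (e.tangentCoord w).1 ∈ e.target := e.map_source hw
  have h2 := ContMDiffAt.comp w (e.contMDiffAt_jet_symm
    (p := ((e.tangentCoord w).1, tailCoord (e.tangentCoord w).2)) hx) h1
  have h3 := ContMDiffAt.comp w (ξ.contMDiffAt_acc e (v := e.jet.symm ((e.tangentCoord w).1,
    tailCoord (e.tangentCoord w).2)) (by
      rw [e.jet_symm_pt hx]
      exact e.map_target hx)) h2
  have h4 : ContDiff ℝ ∞ (fun y : Coord m => (ContinuousLinearMap.id ℝ (Coord (m + 1))).prod
      ((EuclideanSpace.proj (𝕜 := ℝ) (0 : Fin (m + 1))).smulRight (consZero m y))) := by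
    -- Written as a constant plus a composition of linear maps, the dependence on `y` is visibly
    -- smooth.
    have h5 : ContDiff ℝ ∞ (fun y : Coord m => ContinuousLinearMap.inl ℝ (Coord (m + 1))
        (Coord (m + 1)) + ContinuousLinearMap.inr ℝ (Coord (m + 1)) (Coord (m + 1)) ∘L
          (EuclideanSpace.proj (𝕜 := ℝ) (0 : Fin (m + 1))).smulRight (consZero m y)) :=
      contDiff_const.add (contDiff_const.clm_comp (contDiff_const.smulRight (consZero m).contDiff))
    convert h5 using 2 with y
    refine ContinuousLinearMap.ext fun a => ?_
    exact Prod.ext (add_zero a).symm (zero_add _).symm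
  exact h4.contMDiff.contMDiffAt.comp w h3

/-- Three smooth families are composed: the derivative of the chart, the lift in coordinates, and
the derivative of the inverse chart of `TQ`. -/
theorem contMDiffAt_localLift {w₀ : TangentBundle 𝓘(ℝ, Coord (m + 1)) Q}
    (hw : w₀.proj ∈ e.source) :
    ContMDiffAt 𝓘(ℝ, Coord (m + 1)).tangent
      𝓘(ℝ, Coord (m + 1) →L[ℝ] Coord (m + 1) × Coord (m + 1)) ∞
      (inTangentCoordinates 𝓘(ℝ, Coord (m + 1)) 𝓘(ℝ, Coord (m + 1)).tangent
        Bundle.TotalSpace.proj id (fun w => ξ.localLift e w) w₀) w₀ := by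
  have hp : ContMDiffAt 𝓘(ℝ, Coord (m + 1)).tangent 𝓘(ℝ, Coord (m + 1)) ∞
      (Bundle.TotalSpace.proj : TangentBundle 𝓘(ℝ, Coord (m + 1)) Q → Q) w₀ :=
    (Bundle.contMDiff_proj (TangentSpace 𝓘(ℝ, Coord (m + 1)))).contMDiffAt
  have h1 := contMDiffAt_inTangentCoordinates_mfderiv (e.contMDiffAt hw) hp
  have h2 := contMDiffAt_inTangentCoordinates_comp (h := e.tangentCoord)
    (contMDiffAt_inTangentCoordinates_vectorSpace.2 (ξ.contMDiffAt_localLiftCoord hw)) h1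
    ((e.contMDiffAt hw).comp w₀ hp).continuousAt
  have h3 := contMDiffAt_inTangentCoordinates_mfderiv_comp
    (e.contMDiffAt_ofTangentCoord (p := e.tangentCoord w₀) (e.map_source hw))
    (e.contMDiffAt_tangentCoord hw) h2
  refine contMDiffAt_inTangentCoordinates_congr h3 Filter.EventuallyEq.rfl ?_
    Filter.EventuallyEq.rfl
  filter_upwards [e.isOpen_tangent_source.mem_nhds hw] with w hw
  exact (e.ofTangentCoord_tangentCoord hw).symm

theorem mfderiv_proj_localLift {w : TangentBundle 𝓘(ℝ, Coord (m + 1)) Q}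
    (hw : w.proj ∈ e.source) (u : TangentSpace 𝓘(ℝ, Coord (m + 1)) w.proj) :
    mfderiv 𝓘(ℝ, Coord (m + 1)).tangent 𝓘(ℝ, Coord (m + 1)) Bundle.TotalSpace.proj w
      (ξ.localLift e w u) = u := by
  have hx : (e.tangentCoord w).1 ∈ e.target := e.map_source hw
  refine (mfderiv_comp_apply_of_eq_point (e.ofTangentCoord_tangentCoord hw)
    ((Bundle.contMDiff_proj (n := ∞) (TangentSpace 𝓘(ℝ, Coord (m + 1)))).contMDiffAt.mdifferentiableAt
      (by simp)) ((e.contMDiffAt_ofTangentCoord hx).mdifferentiableAt (by simp)) _).symm.trans ?_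
  have h := mfderiv_comp_apply_of_eq_point (I := 𝓘(ℝ, Coord (m + 1) × Coord (m + 1)))
    (I' := 𝓘(ℝ, Coord (m + 1))) (f := ContinuousLinearMap.fst ℝ (Coord (m + 1)) (Coord (m + 1)))
    (g := e.toOpenPartialHomeomorph.symm) (x := e.tangentCoord w)
    (y := e.toOpenPartialHomeomorph w.proj) rfl (e.mdifferentiable.mdifferentiableAt_symm hx)
    (ContinuousLinearMap.fst ℝ (Coord (m + 1)) (Coord (m + 1))).mdifferentiableAt
    (ξ.localLiftCoord e w (e.D w.proj u))
  rw [mfderiv_eq_fderiv (f := ContinuousLinearMap.fst ℝ _ _), ContinuousLinearMap.fderiv] at h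
  exact h.trans (e.Dsymm_D hw u)

/-- In coordinates `ṫ` is the entry of index `0` of the fibre part, where `consZero` has put a zero.
-/
theorem mfderiv_dt_localLift {w : TangentBundle 𝓘(ℝ, Coord (m + 1)) Q}
    (hw : w.proj ∈ e.source) (u : TangentSpace 𝓘(ℝ, Coord (m + 1)) w.proj) :
    mfderiv 𝓘(ℝ, Coord (m + 1)).tangent 𝓘(ℝ, ℝ) B.dt w (ξ.localLift e w u) = (0 : ℝ) := by
  have hx : (e.tangentCoord w).1 ∈ e.target := e.map_source hw
  refine (mfderiv_comp_apply_of_eq_point (e.ofTangentCoord_tangentCoord hw)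
    (contMDiff_dt.contMDiffAt.mdifferentiableAt (by simp))
    ((e.contMDiffAt_ofTangentCoord hx).mdifferentiableAt (by simp)) _).symm.trans ?_
  let P : Coord (m + 1) × Coord (m + 1) →L[ℝ] ℝ :=
    (EuclideanSpace.proj (𝕜 := ℝ) (0 : Fin (m + 1))) ∘L ContinuousLinearMap.snd ℝ _ _
  have h : (fun p => B.dt (e.ofTangentCoord p)) =ᶠ[𝓝 (e.tangentCoord w)] P := by
    filter_upwards [(e.open_target.preimage continuous_fst).mem_nhds hx] with p hp
    rw [← e.dot_zero (w := e.ofTangentCoord p) (e.map_target hp)]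
    exact congrArg (fun z : Coord (m + 1) × Coord (m + 1) => z.2 0)
      (e.tangentCoord_ofTangentCoord hp)
  rw [h.mfderiv_eq, mfderiv_eq_fderiv, P.fderiv]
  exact mul_zero (e.D w.proj u 0 : ℝ)

/-- In coordinates both sides are `((1, qₜ), (0, ξ))`: on the left `a⁰ = 1` for the velocity, on the
right holonomy gives the base part. The resulting equation no longer mentions the chart on its
right-hand side, which is what permits gluing. -/
theorem localLift_vec {v : B.J1} (hv : v.pt ∈ e.source) :
    ξ.localLift e (B.imbed v) v.vec =
      mfderiv 𝓘(ℝ, Coord (m + 1) × Coord m) 𝓘(ℝ, Coord (m + 1)).tangent B.imbed v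
        (ξ.lift v (1 : ℝ)) := by
  have hx : (e.tangentCoord (B.imbed v)).1 ∈ e.target := e.map_source hv
  rw [(e.imbed_eventuallyEq hv).mfderiv_eq]
  refine Eq.trans ?_ (mfderiv_comp_apply_of_eq_point
    (g := e.ofTangentCoord) (f := fun v => Chart.imbedCoord (e.jet v))
    (e.tangentCoord_imbed hv).symm
    ((e.contMDiffAt_ofTangentCoord hx).mdifferentiableAt (by simp))
    ((Chart.contDiff_imbedCoord.contMDiff.contMDiffAt.comp v (e.contMDiffAt_jet hv)).mdifferentiableAt
      (by simp)) _).symm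
  refine congrArg (mfderiv 𝓘(ℝ, Coord (m + 1) × Coord (m + 1)) 𝓘(ℝ, Coord (m + 1)).tangent
    e.ofTangentCoord (e.tangentCoord (B.imbed v))) ?_
  refine Eq.trans ?_ (mfderiv_comp_apply_of_eq_point (g := Chart.imbedCoord) (f := e.jet) rfl
    (Chart.contDiff_imbedCoord.contMDiff.contMDiffAt.mdifferentiableAt (by simp))
    ((e.contMDiffAt_jet hv).mdifferentiableAt (by simp)) _).symm
  rw [mfderiv_eq_fderiv]
  refine Eq.trans ?_ (fderiv_imbedCoord _ _).symm
  have hj : mfderiv 𝓘(ℝ, Coord (m + 1) × Coord m) 𝓘(ℝ, Coord (m + 1) × Coord m) e.jet v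
      (ξ.lift v (1 : ℝ)) = (e.D v.pt v.vec, ξ.acc e v) :=
    (e.mfderiv_jet hv _).trans (Prod.ext (congrArg (e.D v.pt) (ξ.holonomic v)) rfl)
  refine Prod.ext (congrArg Prod.fst hj).symm (Eq.trans ?_
    (congrArg (fun z : Coord (m + 1) × Coord m => consZero m z.2) hj).symm)
  have h1 : e.D v.pt v.vec 0 = 1 := (e.D_zero hv v.vec).trans v.dt_vec
  have h2 : e.jet.symm (e.jet v) = v := e.jet.left_inv hv
  change e.D v.pt v.vec 0 • consZero m (ξ.acc e (e.jet.symm (e.jet v))) = consZero m (ξ.acc e v)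
  rw [h1, h2, one_smul]

/-- Apply `dq̇ⁱ` to the hypothesis. As `qⁱₜ = q̇ⁱ ∘ λ`, the right side gives `ξⁱ`; expanding the
velocity in the vectors `∂_μ` on the left gives the contraction of `K`. -/
theorem hasForm_of_lift_vec {K : B.TangentConnection}
    (h : ∀ v : B.J1, K.lift (B.imbed v) v.vec =
      mfderiv 𝓘(ℝ, Coord (m + 1) × Coord m) 𝓘(ℝ, Coord (m + 1)).tangent B.imbed v
        (ξ.lift v (1 : ℝ))) : ξ.HasForm K := by
  intro e v hv i
  have h1 : ξ.comp e i v = mfderiv 𝓘(ℝ, Coord (m + 1)).tangent 𝓘(ℝ, ℝ) (e.dot i.succ) (B.imbed v)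
      (K.lift (B.imbed v) v.vec) := by
    rw [h v]
    exact mfderiv_comp_apply_of_eq_point (g := e.dot i.succ) (f := B.imbed) rfl
      ((e.contMDiffAt_dot i.succ hv).mdifferentiableAt (by simp))
      (contMDiff_imbed.contMDiffAt.mdifferentiableAt (by simp)) _
  have h2 : K.lift (B.imbed v) v.vec = K.lift (B.imbed v) (e.partialVec 0 v.pt) +
      ∑ j : Fin m, e.vel j v • K.lift (B.imbed v) (e.partialVec j.succ v.pt) := by
    refine (congrArg (K.lift (B.imbed v)) (e.vec_eq hv)).trans ?_
    refine (map_add (K.lift (B.imbed v)) _ _).trans (congrArg _ ?_)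
    refine (map_sum (K.lift (B.imbed v)) _ _).trans (Finset.sum_congr rfl fun j _ => ?_)
    exact map_smul (K.lift (B.imbed v)) _ _
  rw [h1, h2]
  simp only [map_add, map_sum, map_smul]
  rfl

theorem exists_tangentConnection [T2Space Q] [SecondCountableTopology Q] :
    ∃ K : B.TangentConnection, K.TimeComponentsVanish ∧ ξ.HasForm K := by
  -- Together with second countability this makes `Q` σ-compact, as partitions of unity require.
  have : LocallyCompactSpace Q := ChartedSpace.locallyCompactSpace (Coord (m + 1)) Q
  let c : Q → B.Chart := fun q => (B.exists_chart q).choose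
  have hc : ∀ q, q ∈ (c q).source := fun q => (B.exists_chart q).choose_spec
  obtain ⟨ρ, hρ⟩ := SmoothPartitionOfUnity.exists_isSubordinate 𝓘(ℝ, Coord (m + 1))
    (isClosed_univ (X := Q)) (fun q => (c q).source) (fun q => (c q).open_source)
    (fun q _ => mem_iUnion.2 ⟨q, hc q⟩)
  have hmem : ∀ {i q}, i ∈ ρ.finsupport q → q ∈ (c i).source := fun {i q} hi =>
    hρ i ((ρ.mem_fintsupport_iff q i).1 (ρ.finsupport_subset_fintsupport q hi))
  let K : B.TangentConnection := Connection.glue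
    (Bundle.contMDiff_proj (TangentSpace 𝓘(ℝ, Coord (m + 1)))) ρ
    (fun i w => ξ.localLift (c i) w) (fun i w hw u => ξ.mfderiv_proj_localLift (hρ i hw) u)
    (fun i w hw => ξ.contMDiffAt_localLift (hρ i hw))
  have hK : ∀ (w : TangentBundle 𝓘(ℝ, Coord (m + 1)) Q)
      (u : TangentSpace 𝓘(ℝ, Coord (m + 1)) w.proj), K.lift w u =
        ∑ i ∈ ρ.finsupport w.proj, ρ i w.proj • ξ.localLift (c i) w u := fun w u =>
    sum_apply _ _ _
  refine ⟨K, fun e w hw μ => ?_, ξ.hasForm_of_lift_vec fun v => ?_⟩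
  · refine (DFunLike.congr_fun (e.dot_zero_eventuallyEq hw).mfderiv_eq _).trans ?_
    refine (congrArg (mfderiv 𝓘(ℝ, Coord (m + 1)).tangent 𝓘(ℝ, ℝ) B.dt w) (hK w _)).trans ?_
    refine (map_sum (mfderiv 𝓘(ℝ, Coord (m + 1)).tangent 𝓘(ℝ, ℝ) B.dt w) _ _).trans ?_
    refine Finset.sum_eq_zero fun i hi => ?_
    rw [map_smul]
    exact (congrArg (fun z : ℝ => ρ i w.proj • z)
      (ξ.mfderiv_dt_localLift (hmem hi) (e.partialVec μ w.proj))).trans (smul_zero _)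
  -- Every local lift with nonzero weight sends the velocity to the same vector `Tλ(ξ(∂ₜ))`, so the
  -- weights factor out and sum to one.
  · refine (hK (B.imbed v) v.vec).trans ?_
    refine (Finset.sum_congr rfl fun i hi => congrArg (ρ i v.pt • ·)
      (ξ.localLift_vec (hmem hi))).trans ?_
    rw [← Finset.sum_smul]
    refine (congrArg (fun z : ℝ => z • _) (ρ.sum_finsupport v.pt (mem_univ _))).trans ?_
    exact one_smul ℝ _

end DynamicEquation

end ConfigurationBundle

end TimeDependentMechanics
end

open TimeDependentMechanics TimeDependentMechanics.ConfigurationBundle in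
theorem proposition5p1 {m : ℕ} {Q M : Type*}
    [TopologicalSpace Q] [T2Space Q] [SecondCountableTopology Q]
    [ChartedSpace (Coord (m + 1)) Q] [IsManifold 𝓘(ℝ, Coord (m + 1)) ∞ Q]
    [TopologicalSpace M] [ChartedSpace (Coord m) M] [IsManifold 𝓘(ℝ, Coord m) ∞ M]
    (B : ConfigurationBundle m Q M) :
    (∀ ξ : B.DynamicEquation, ∃ (K : B.TangentConnection) (γ : B.DynamicConnection),
      K.TimeComponentsVanish ∧ K.RestrictsTo γ ∧ γ.Yields ξ ∧ ξ.HasForm K) ∧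
    (∀ K : B.TangentConnection, K.TimeComponentsVanish →
      (∃! γ : B.DynamicConnection, K.RestrictsTo γ) ∧
      (∃! ξ : B.DynamicEquation, ξ.HasForm K) ∧
      (∀ (γ : B.DynamicConnection) (ξ : B.DynamicEquation),
        K.RestrictsTo γ → ξ.HasForm K → γ.Yields ξ)) := by
  have hγ : ∀ K : B.TangentConnection, K.TimeComponentsVanish →
      K.RestrictsTo K.toDynamicConnection := fun K hK => K.restrictsTo_toDynamicConnection hK
  refine ⟨fun ξ => ?_, fun K hK => ⟨⟨K.toDynamicConnection, hγ K hK, fun γ h => ?_⟩,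
    ⟨K.toDynamicConnection.toDynamicEquation, ?_, fun ξ h => ?_⟩, fun γ ξ h => ?_⟩⟩
  · obtain ⟨K, hK, h⟩ := ξ.exists_tangentConnection
    exact ⟨K, K.toDynamicConnection, hK, hγ K hK, ((hγ K hK).hasForm_iff_yields ξ).1 h, h⟩
  · exact DynamicConnection.ext_comp fun e v hv i μ =>
      (h e v hv i μ).trans (hγ K hK e v hv i μ).symm
  · exact ((hγ K hK).hasForm_iff_yields _).2 (DynamicConnection.yields_toDynamicEquation _)
  · exact DynamicEquation.ext_comp fun e v hv i => (h e v hv i).trans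
      (((hγ K hK).hasForm_iff_yields _).2 (DynamicConnection.yields_toDynamicEquation _)
        e v hv i).symm
  · exact (h.hasForm_iff_yields ξ).1
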